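/- **Conventions.** $\mathbf{Met}$ is the category of extended metric spaces (metrics valued in $[0,\infty]$) and nonexpansive maps; $\mathbf{CMet}$ is its full subcategory of countable spaces. $Y^X$ is the space of nonexpansive maps $X\to Y$ with the supremum metric. A $\mathbf{Met}$-category is a category with a metric on each hom-set such that $d(gf,g'f')\le d(g,g')+d(f,f')$; a functor is enriched if it is nonexpansive on hom-sets. A power $X^V$ is an object with a nonexpansive family $V\to\mathcal C(X^V,X)$ inducing isometric bijections $\mathcal C(A,X^V)\to\mathcal C(A,X)^V$ for all $A$. A *$\mathbf{Met}$-Lawvere theory* is a $\mathbf{Met}$-category $\mathcal L$ with an enriched identity-on-objects functor $\mathbf{CMet}^{op}\to\mathcal L$ preserving powers by countable spaces. A *model* of $\mathcal L$ is an enriched functor $\mathcal L\to\mathbf{Met}$ preserving powers by countable spaces; $Mod(\mathcal L)$ is the category of models and natural transformations, with forgetful functor $M\mapsto M(x)$ to $\mathbf{Met}$, where $x$ is the image of the one-point space. A *metric signature* $\Omega$ is a set of operation symbols $f$, each with a countable extended metric space $(N,d)$ as arity. *Preterms* over a countably infinite set of variables are generated by $f((t_i)_{i\in N})$. A *context* $\Gamma$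 is a countable list of formal equalities $x=_\varepsilon y$ between variables ($\varepsilon\in\mathbb R_{\ge0}$). A *judgment* is $\Gamma\vdash t\ ok$ or $\Gamma\vdash s=_\varepsilon t$. Given a set $S$ of judgments, $\vdash_S$ is the least set of judgments containing $S$ and closed under the following rules (hypotheses about $d(i,j)$ are imposed only for $d(i,j)<\infty$): - $\Gamma\vdash x\ ok$ for each variable $x$; $\Gamma\vdash x=_\varepsilon y$ if $(x=_\varepsilon y)\in\Gamma$; - from $\Gamma\vdash t\ ok$ infer $\Gamma\vdash t=_0t$; from $\Gamma\vdash t=_\varepsilon t'$ infer $\Gamma\vdash t'=_\varepsilon t$; from $\Gamma\vdash t=_\varepsilon t'$ and $\Gamma\vdash t'=_{\varepsilon'}t''$ infer $\Gamma\vdash t=_{\varepsilon+\varepsilon'}t''$; - from $\Gamma\vdash t=_{\varepsilon'}t'$ with $\varepsilon'<\varepsilon$ infer $\Gamma\vdash t=_\varepsilon t'$; from $\Gamma\vdash t=_{\varepsilon'}t'$ for all $\varepsilon'>\varepsilon$ infer $\Gamma\vdash t=_\varepsilon t'$; - for $f$ of arity $(N,d)$: from $\Gamma\vdash t_i\ ok$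 and $\Gamma\vdash t_i=_{d(i,j)}t_j$ for all $i,j$ infer $\Gamma\vdash f((t_i))\ ok$; from $\Gamma\vdash s_i=_{d(i,j)}s_j$, $\Gamma\vdash t_i=_{d(i,j)}t_j$ and $\Gamma\vdash s_i=_\varepsilon t_i$ for all $i,j$ infer $\Gamma\vdash f((s_i))=_\varepsilon f((t_i))$; - from $\Delta\vdash s=_\varepsilon t$ and $\Gamma\vdash\sigma(x)=_\delta\sigma(y)$ for all $(x=_\delta y)\in\Delta$ infer $\Gamma\vdash s[\sigma]=_\varepsilon t[\sigma]$, for each substitution $\sigma$ of preterms for variables that fixes the variables not occurring in $\Delta$. A *metric equational theory* (MET) over $\Omega$ is a set $\mathbb T$ of judgments such that $(\Gamma\vdash s=_\varepsilon t)\in\mathbb T$ implies $(\Gamma\vdash s\ ok),(\Gamma\vdash t\ ok)\in\mathbb T$, and $\mathbb T$ is exactly $\vdash_{\mathbb T^=}$, where $\mathbb T^=\subseteq\mathbb T$ consists of the equational judgments. A *model* of $\Omega$ is an extended metric space $M$ with a nonexpansive map $M[f]:M^N\to M$ for each $f$ of arity $N$; homomorphisms are nonexpansive maps commuting with the operations.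 Fix a context $\Gamma$. Always $M$ satisfies $\Gamma\vdash x\ ok$, and $M[x](\alpha)=\alpha(x)$ for each assignment $\alpha$ in $M$ satisfying $\Gamma$ (i.e. $d(\alpha(x),\alpha(y))\le\varepsilon$ for all $(x=_\varepsilon y)\in\Gamma$). $M$ satisfies $\Gamma\vdash f((t_i))\ ok$ if it satisfies every $\Gamma\vdash t_i\ ok$ and $d(M[t_i](\alpha),M[t_j](\alpha))\le d(i,j)$ for all $i,j$ and all such $\alpha$; then $M[f((t_i))](\alpha)=M[f]((M[t_i](\alpha))_i)$. $M$ satisfies $\Gamma\vdash s=_\varepsilon t$ if it satisfies $\Gamma\vdash s\ ok$ and $\Gamma\vdash t\ ok$ and $d(M[s](\alpha),M[t](\alpha))\le\varepsilon$ for all such $\alpha$. $Mod(\mathbb T)$ is the full subcategory of the models of $\Omega$ that satisfy every judgment of $\mathbb T$. **Statement.** Let $\mathbb T$ be a metric equational theory. 1. The forgetful functor $Mod(\mathbb T)\to\mathbf{Met}$ has a left adjoint, and the induced free-model monad $Free^{\mathbb T}:\mathbf{Met}\to\mathbf{Met}$ (for any choice of left adjoint) preserves all small countably filtered (i.e. $\aleph_1$-filtered)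 colimits. 2. There is a $\mathbf{Met}$-Lawvere theory $\mathcal L$ with an equivalence of categories $Mod(\mathbb T)\simeq Mod(\mathcal L)$ which commutes, up to natural isomorphism, with the forgetful functors to $\mathbf{Met}$. -/

import Mathlib

open CategoryTheory Opposite
open scoped ENNReal NNReal Cardinal

universe u v w

/-! ### Extended metric spaces and nonexpansive maps -/

/-- A map of extended metric spaces is nonexpansive if it does not increase distances. -/
def Nonexpansive {X : Type u} {Y : Type v} [EMetricSpace X] [EMetricSpace Y] (f : X → Y) : Prop :=
  ∀ x y, edist (f x) (f y) ≤ edist x y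

/-- The set `Y ^ X` of nonexpansive maps from `X` to `Y`. -/
@[ext]
structure NonexpMap (X : Type u) (Y : Type v) [EMetricSpace X] [EMetricSpace Y] where
  toFun : X → Y
  nonexpansive : Nonexpansive toFun

namespace NonexpMap

variable {X : Type u} {Y : Type v} {Z : Type w} [EMetricSpace X] [EMetricSpace Y] [EMetricSpace Z]

instance : CoeFun (NonexpMap X Y) (fun _ => X → Y) := ⟨NonexpMap.toFun⟩

/-- The supremum metric on `Y ^ X`. -/
noncomputable instance : EMetricSpace (NonexpMap X Y) where
  edist f g := ⨆ x, edist (f x) (g x)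
  edist_self f := by simp
  edist_comm f g := by simp only [edist_comm]
  edist_triangle f g h := iSup_le fun x => (edist_triangle _ (g x) _).trans
    (add_le_add (le_iSup (fun x => edist (f x) (g x)) x) (le_iSup (fun x => edist (g x) (h x)) x))
  eq_of_edist_eq_zero {f g} h := by
    ext x
    exact eq_of_edist_eq_zero (le_antisymm ((le_iSup (fun x => edist (f x) (g x)) x).trans h.le)
      (zero_le))

theorem edist_def (f g : NonexpMap X Y) : edist f g = ⨆ x, edist (f x) (g x) := rfl

/-- The identity map. -/
def id (X : Type u) [EMetricSpace X] : NonexpMap X X := ⟨fun x => x, fun _ _ => le_rfl⟩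

/-- `g.comp f` is the composite `x ↦ g (f x)`. -/
def comp (g : NonexpMap Y Z) (f : NonexpMap X Y) : NonexpMap X Z :=
  ⟨fun x => g (f x), fun x y => (g.nonexpansive _ _).trans (f.nonexpansive x y)⟩

end NonexpMap

/-- The objects of the category `Met`: extended metric spaces. -/
structure Met : Type (u + 1) where
  carrier : Type u
  [str : EMetricSpace carrier]

attribute [instance] Met.str

namespace Met

instance : CoeSort Met.{u} (Type u) := ⟨Met.carrier⟩

/-- The category of extended metric spaces and nonexpansive maps. -/
instance : Category.{u} Met.{u} where
  Hom X Y := NonexpMap X Y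
  id X := NonexpMap.id X
  comp f g := NonexpMap.comp g f

end Met

/-! ### Categories enriched in `Met` -/

/-- A `Met`-enrichment of an ordinary category: a metric on each hom-set such that composition
`C(Y, Z) ⊗ C(X, Y) → C(X, Z)` is nonexpansive, where `⊗` carries the sum metric. -/
class MetCategory (C : Type u) [Category.{v} C] where
  homMetric : ∀ X Y : C, EMetricSpace (X ⟶ Y)
  edist_comp_le : ∀ {X Y Z : C} (f f' : X ⟶ Y) (g g' : Y ⟶ Z),
    edist (f ≫ g) (f' ≫ g') ≤ edist f f' + edist g g'

attribute [reducible, instance] MetCategory.homMetric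

/-- `Met` is enriched in itself through the supremum metric. -/
noncomputable instance : MetCategory Met.{u} where
  homMetric X Y := inferInstanceAs (EMetricSpace (NonexpMap X Y))
  edist_comp_le {X Y Z} f f' g g' := iSup_le fun x => by
    refine (edist_triangle (g.toFun (f.toFun x)) (g.toFun (f'.toFun x))
      (g'.toFun (f'.toFun x))).trans (add_le_add ?_ ?_)
    · exact (g.nonexpansive _ _).trans (le_iSup (fun x => edist (f.toFun x) (f'.toFun x)) x)
    · exact le_iSup (fun y => edist (g.toFun y) (g'.toFun y)) (f'.toFun x)

/-- The enrichment inherited by a full subcategory. -/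
instance {C : Type u} [Category.{v} C] [MetCategory C] (P : ObjectProperty C) :
    MetCategory P.FullSubcategory where
  homMetric X Y := EMetricSpace.induced (fun f : X ⟶ Y => f.hom)
    (fun _ _ h => ObjectProperty.hom_ext P h) inferInstance
  edist_comp_le f f' g g' := MetCategory.edist_comp_le f.hom f'.hom g.hom g'.hom

/-- The enrichment of the opposite category. -/
instance {C : Type u} [Category.{v} C] [MetCategory C] : MetCategory Cᵒᵖ where
  homMetric X Y := EMetricSpace.induced (fun f : X ⟶ Y => f.unop)
    Quiver.Hom.unop_inj inferInstance
  edist_comp_le f f' g g' :=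
    (MetCategory.edist_comp_le g.unop g'.unop f.unop f'.unop).trans_eq (add_comm _ _)

section Enriched

variable {C : Type u} [Category.{v} C] [MetCategory C]

/-- A functor between `Met`-categories is enriched if it is nonexpansive on hom-sets. -/
def IsMetFunctor {D : Type*} [Category* D] [MetCategory D] (F : C ⥤ D) : Prop :=
  ∀ X Y : C, Nonexpansive (fun f : X ⟶ Y => F.map f)

/-- The object `P`, with the family of projections `π`, is a power (cotensor) `X ^ V`:
`π` is a nonexpansive map `V → C(P, X)`, and for every object `A` the induced map
`C(A, P) → [V, C(A, X)]`, `g ↦ (v ↦ g ≫ π v)`, is a bijective isometry. -/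
structure IsPower (V : Type w) [EMetricSpace V] {P X : C} (π : V → (P ⟶ X)) : Prop where
  nonexpansive : Nonexpansive π
  lift : ∀ (A : C) (φ : V → (A ⟶ X)), Nonexpansive φ → ∃! g : A ⟶ P, ∀ v, g ≫ π v = φ v
  isometry : ∀ (A : C) (g h : A ⟶ P), edist g h = ⨆ v, edist (g ≫ π v) (h ≫ π v)

/-- The functor `F` preserves powers by countable metric spaces. -/
def PreservesCountablePowers {D : Type*} [Category* D] [MetCategory D] (F : C ⥤ D) : Prop :=
  ∀ (V : Type) [EMetricSpace V] [Countable V] (P X : C) (π : V → (P ⟶ X)),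
    IsPower V π → IsPower V (fun v => F.map (π v))

end Enriched

/-! ### Enriched Lawvere theories -/

/-- The full subcategory of `Met` on the countable extended metric spaces. -/
abbrev CMet : Type (u + 1) :=
  ObjectProperty.FullSubcategory (fun X : Met.{u} => Countable X)

/-- The one-point metric space. -/
noncomputable def CMet.point : CMet.{u} := ⟨⟨PUnit.{u + 1}⟩, inferInstance⟩

/-- A `Met`-Lawvere theory: a `Met`-category with an enriched functor from the opposite of `CMet`
that preserves powers by countable spaces and identifies the objects of the two categories. -/
structure MetLawvereTheory : Type (u + 2) where
  Obj : Type (u + 1)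
  [category : Category.{u} Obj]
  [enrichment : MetCategory Obj]
  functor : CMet.{u}ᵒᵖ ⥤ Obj
  bijective_obj : Function.Bijective functor.obj
  enriched : IsMetFunctor functor
  preservesPowers : PreservesCountablePowers functor

namespace MetLawvereTheory

attribute [instance] category enrichment

variable (L : MetLawvereTheory.{u})

/-- The distinguished object `x`, the image of the one-point space. -/
noncomputable def generator : L.Obj := L.functor.obj (op CMet.point)

/-- The category of models: the enriched functors to `Met` that preserve countable powers, and
their natural transformations. -/
abbrev Mod : Type (u + 1) :=
  ObjectProperty.FullSubcategory
    (fun M : L.Obj ⥤ Met.{u} => IsMetFunctor M ∧ PreservesCountablePowers M)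

/-- The forgetful functor `M ↦ M(x)`. -/
noncomputable def forget : L.Mod ⥤ Met.{u} :=
  ObjectProperty.ι _ ⋙ (evaluation L.Obj Met.{u}).obj L.generator

end MetLawvereTheory

/-! ### Metric signatures, preterms, judgments -/

/-- A metric signature: operation symbols with countable metric spaces as arities. -/
structure MetricSignature : Type (u + 1) where
  Op : Type u
  arity : Op → Type
  [metric : ∀ f, EMetricSpace (arity f)]
  [countable : ∀ f, Countable (arity f)]

attribute [instance] MetricSignature.metric MetricSignature.countable

/-- Preterms over a set `X` of variables. -/
inductive Preterm (Ω : MetricSignature.{u}) (X : Type v) : Type (max u v)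
  | var (x : X) : Preterm Ω X
  | app (f : Ω.Op) (t : Ω.arity f → Preterm Ω X) : Preterm Ω X

/-- Simultaneous substitution. -/
def Preterm.subst {Ω : MetricSignature.{u}} {X : Type v} {Y : Type w} (σ : X → Preterm Ω Y) :
    Preterm Ω X → Preterm Ω Y
  | .var x => σ x
  | .app f t => .app f (fun i => (t i).subst σ)

/-- A quantitative equality `lhs =_bound rhs` between variables. -/
structure VarEq (X : Type v) where
  lhs : X
  rhs : X
  bound : ℝ≥0

/-- A context: a (finite or infinite) list of quantitative equalities between variables, of which
only the countable set of its members matters. -/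
structure MetContext (X : Type v) where
  eqs : Set (VarEq X)
  countable : eqs.Countable

namespace MetContext

variable {X : Type v}

/-- The variables that occur in a context. -/
def vars (Γ : MetContext X) : Set X := {x | ∃ e ∈ Γ.eqs, e.lhs = x ∨ e.rhs = x}

/-- The assignment `α` satisfies all equalities of the context `Γ`. -/
def Satisfies {M : Type u} [EMetricSpace M] (Γ : MetContext X) (α : X → M) : Prop :=
  ∀ e ∈ Γ.eqs, edist (α e.lhs) (α e.rhs) ≤ e.bound

/-- The assignments in `M` that satisfy `Γ`. -/
def Assign (Γ : MetContext X) (M : Type u) [EMetricSpace M] : Type (max u v) :=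
  {α : X → M // Γ.Satisfies α}

end MetContext

/-- Judgments `Γ ⊢ t ok` and `Γ ⊢ s =_ε t`, over the countably infinite set `ℕ` of variables. -/
inductive MetJudgment (Ω : MetricSignature.{u}) : Type u
  | ok (Γ : MetContext ℕ) (t : Preterm Ω ℕ) : MetJudgment Ω
  | eq (Γ : MetContext ℕ) (s t : Preterm Ω ℕ) (ε : ℝ≥0) : MetJudgment Ω

open MetJudgment in
/-- The least deducibility relation `⊢_S` that contains the set `S` of judgments. -/
inductive MetDerives {Ω : MetricSignature.{u}} (S : Set (MetJudgment Ω)) : MetJudgment Ω → Prop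
  | ax {j : MetJudgment Ω} : j ∈ S → MetDerives S j
  | var (Γ : MetContext ℕ) (x : ℕ) : MetDerives S (ok Γ (.var x))
  | assum (Γ : MetContext ℕ) (e : VarEq ℕ) :
      e ∈ Γ.eqs → MetDerives S (eq Γ (.var e.lhs) (.var e.rhs) e.bound)
  | refl {Γ : MetContext ℕ} {t : Preterm Ω ℕ} :
      MetDerives S (ok Γ t) → MetDerives S (eq Γ t t 0)
  | symm {Γ : MetContext ℕ} {t t' : Preterm Ω ℕ} {ε : ℝ≥0} :
      MetDerives S (eq Γ t t' ε) → MetDerives S (eq Γ t' t ε)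
  | triang {Γ : MetContext ℕ} {t t' t'' : Preterm Ω ℕ} {ε ε' : ℝ≥0} :
      MetDerives S (eq Γ t t' ε) → MetDerives S (eq Γ t' t'' ε') →
      MetDerives S (eq Γ t t'' (ε + ε'))
  | max {Γ : MetContext ℕ} {t t' : Preterm Ω ℕ} {ε ε' : ℝ≥0} :
      ε' < ε → MetDerives S (eq Γ t t' ε') → MetDerives S (eq Γ t t' ε)
  | cont {Γ : MetContext ℕ} {t t' : Preterm Ω ℕ} {ε : ℝ≥0} :
      (∀ ε', ε < ε' → MetDerives S (eq Γ t t' ε')) → MetDerives S (eq Γ t t' ε)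
  | nexp {Γ : MetContext ℕ} (f : Ω.Op) {s t : Ω.arity f → Preterm Ω ℕ} {ε : ℝ≥0} :
      (∀ (i j : Ω.arity f) (δ : ℝ≥0), edist i j = δ → MetDerives S (eq Γ (s i) (s j) δ)) →
      (∀ (i j : Ω.arity f) (δ : ℝ≥0), edist i j = δ → MetDerives S (eq Γ (t i) (t j) δ)) →
      (∀ i, MetDerives S (eq Γ (s i) (t i) ε)) →
      MetDerives S (eq Γ (.app f s) (.app f t) ε)
  | subst {Γ Δ : MetContext ℕ} (σ : ℕ → Preterm Ω ℕ) {s t : Preterm Ω ℕ} {ε : ℝ≥0} :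
      (∀ x, x ∉ Δ.vars → σ x = .var x) →
      (∀ e ∈ Δ.eqs, MetDerives S (eq Γ (σ e.lhs) (σ e.rhs) e.bound)) →
      MetDerives S (eq Δ s t ε) → MetDerives S (eq Γ (s.subst σ) (t.subst σ) ε)
  | app {Γ : MetContext ℕ} (f : Ω.Op) {t : Ω.arity f → Preterm Ω ℕ} :
      (∀ i, MetDerives S (ok Γ (t i))) →
      (∀ (i j : Ω.arity f) (δ : ℝ≥0), edist i j = δ → MetDerives S (eq Γ (t i) (t j) δ)) →
      MetDerives S (ok Γ (.app f t))

/-- The equational judgments in a set of judgments. -/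
def equationalPart {Ω : MetricSignature.{u}} (S : Set (MetJudgment Ω)) : Set (MetJudgment Ω) :=
  {j | j ∈ S ∧ ∃ Γ s t ε, j = MetJudgment.eq Γ s t ε}

/-- A metric equational theory: a well-formed collection of judgments that is the deducibility
relation generated by its equational judgments. -/
structure MetricEquationalTheory (Ω : MetricSignature.{u}) where
  judgments : Set (MetJudgment Ω)
  wellFormed : ∀ Γ s t ε, MetJudgment.eq Γ s t ε ∈ judgments →
    MetJudgment.ok Γ s ∈ judgments ∧ MetJudgment.ok Γ t ∈ judgments
  generated : judgments = {j | MetDerives (equationalPart judgments) j}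

/-! ### Models -/

/-- A model of the signature `Ω`: an extended metric space `M` with a nonexpansive map
`M ^ A → M` for each operation symbol of arity `A`. -/
structure SigModel (Ω : MetricSignature.{u}) : Type (u + 1) where
  space : Met.{u}
  op : ∀ f : Ω.Op, NonexpMap (NonexpMap (Ω.arity f) space) space

namespace SigModel

variable {Ω : MetricSignature.{u}}

/-- Homomorphisms: nonexpansive maps that commute with the operations. -/
@[ext]
structure Hom (M N : SigModel Ω) where
  map : M.space ⟶ N.space
  map_op : ∀ (f : Ω.Op) (a : NonexpMap (Ω.arity f) M.space),
    map.toFun (M.op f a) = N.op f (NonexpMap.comp map a)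

instance : Category.{u} (SigModel Ω) where
  Hom := Hom
  id M := ⟨𝟙 M.space, fun _ _ => rfl⟩
  comp φ ψ := ⟨φ.map ≫ ψ.map, fun f a => by
    change ψ.map.toFun (φ.map.toFun _) = _
    rw [φ.map_op, ψ.map_op]; rfl⟩

/-- The functor that forgets the operations. -/
def forget (Ω : MetricSignature.{u}) : SigModel Ω ⥤ Met.{u} where
  obj M := M.space
  map φ := φ.map

/-- The interpretation of a preterm in a context. It is defined exactly when `M` satisfies
`Γ ⊢ t ok`, and is then a function on the assignments that satisfy `Γ`. -/
def interp (M : SigModel Ω) {X : Type v} (Γ : MetContext X) :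
    Preterm Ω X → Part (Γ.Assign M.space → M.space)
  | .var x => Part.some (fun α => α.1 x)
  | .app f t =>
    { Dom := ∃ h : ∀ i, (M.interp Γ (t i)).Dom, ∀ i j α,
        edist ((M.interp Γ (t i)).get (h i) α) ((M.interp Γ (t j)).get (h j) α) ≤ edist i j
      get := fun h α => M.op f
        ⟨fun i => (M.interp Γ (t i)).get (h.1 i) α, fun i j => h.2 i j α⟩ }

/-- `M` satisfies a judgment. -/
def Satisfies (M : SigModel Ω) : MetJudgment Ω → Prop
  | .ok Γ t => (M.interp Γ t).Dom
  | .eq Γ s t ε => ∃ (hs : (M.interp Γ s).Dom) (ht : (M.interp Γ t).Dom),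
      ∀ α, edist ((M.interp Γ s).get hs α) ((M.interp Γ t).get ht α) ≤ ε

end SigModel

namespace MetricEquationalTheory

variable {Ω : MetricSignature.{u}} (T : MetricEquationalTheory Ω)

/-- The category of models of a theory: the full subcategory of the models of its signature that
satisfy every judgment of the theory. -/
abbrev Mod : Type (u + 1) :=
  ObjectProperty.FullSubcategory (fun M : SigModel Ω => ∀ j ∈ T.judgments, M.Satisfies j)

/-- The forgetful functor to `Met`. -/
def forget : T.Mod ⥤ Met.{u} := ObjectProperty.ι _ ⋙ SigModel.forget Ω

end MetricEquationalTheory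

/-! ### Countable arity -/

/-- `ℵ₁` is regular, so that `ℵ₁`-filtered categories and `ℵ₁`-accessible functors make sense:
a functor is `ℵ₁`-accessible if it preserves all small countably filtered colimits. -/
instance fact_isRegular_aleph_one : Fact (ℵ₁ : Cardinal.{u}).IsRegular :=
  ⟨Cardinal.isRegular_aleph_one⟩

/-!
The argument uses two properties of the class of models of `T`: a structure `F` is a model if the
homomorphisms from `F` to models are jointly isometric, and a structure `M` is a model if every
countable nonexpansive family in `M` factors through a homomorphism from a model. The former holds
since judgments are tested by distances of interpretations, the latter since an assignment of the
countably many variables is a countable family.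

* The free model on `X` consists of the preterms over `X` that have a value at each nonexpansive map
  from `X` to a model, and the distance of two of them is the supremum of the distances of their
  values. It is separated by homomorphisms to models, hence a model.
* In a countably filtered colimit of metric spaces, countably many inequalities between distances
  hold at a common stage, since an inequality `d ≤ r` amounts to the countably many inequalities
  `d < u n` for a sequence `u` decreasing to `r`. Hence nonexpansive maps from countable spaces lift
  to a stage. As arities are countable, the colimit of structures is formed on the underlying
  spaces; it is countably covered by the stages, hence a model if they are.
* The theory is the opposite of the category of free models on countable spaces, and the nerve
  sends `M` to the homomorphisms from these free models to `M`. Conversely, the value of a model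
  `N` of the theory at the generator is a structure: an operation of arity `A` is an element of the
  free model on `A`, hence a morphism from `A` to the generator, and `N` preserves the power `A`.
  Countable families in this structure factor through evaluations of free models, so that it is a
  model.
-/

namespace NonexpMap

variable {X : Type u} {Y : Type v} [EMetricSpace X] [EMetricSpace Y]

theorem edist_apply_le (f g : NonexpMap X Y) (x : X) : edist (f x) (g x) ≤ edist f g :=
  le_iSup (fun x => edist (f x) (g x)) x

/-- A constant map. -/
def const (X : Type u) [EMetricSpace X] (y : Y) : NonexpMap X Y :=
  ⟨fun _ => y, fun _ _ => (edist_self y).trans_le zero_le⟩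

end NonexpMap

/-! ### Powers -/

section Powers

variable {C : Type*} [Category* C] [MetCategory C] {D : Type*} [Category* D] [MetCategory D]
  {V : Type v} [EMetricSpace V] {W : Type w} [EMetricSpace W]

namespace MetCategory

theorem edist_comp_le_left {X Y Z : C} (f f' : X ⟶ Y) (g : Y ⟶ Z) :
    edist (f ≫ g) (f' ≫ g) ≤ edist f f' := by
  simpa using edist_comp_le f f' g g

theorem edist_comp_le_right {X Y Z : C} (f : X ⟶ Y) (g g' : Y ⟶ Z) :
    edist (f ≫ g) (f ≫ g') ≤ edist g g' := by
  simpa using edist_comp_le f f g g'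

instance {A : Type*} (F : A → C) : MetCategory (InducedCategory C F) where
  homMetric X Y := EMetricSpace.induced (fun f : X ⟶ Y => f.hom)
    (fun _ _ h => InducedCategory.hom_ext h) inferInstance
  edist_comp_le f f' g g' := edist_comp_le f.hom f'.hom g.hom g'.hom

end MetCategory

theorem IsMetFunctor.op {F : C ⥤ D} (hF : IsMetFunctor F) : IsMetFunctor F.op :=
  fun _ _ f g => hF _ _ f.unop g.unop

/-- An adjunction of enriched functors. Its bijections between hom-sets are then isometries. -/
structure MetAdjunction (F : C ⥤ D) (G : D ⥤ C) extends F ⊣ G where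
  isMetFunctor_left : IsMetFunctor F
  isMetFunctor_right : IsMetFunctor G

namespace MetAdjunction

variable {F : C ⥤ D} {G : D ⥤ C} (adj : MetAdjunction F G)

/-- The opposite adjunction. -/
protected def op : MetAdjunction G.op F.op where
  toAdjunction := adj.toAdjunction.op
  isMetFunctor_left := adj.isMetFunctor_right.op
  isMetFunctor_right := adj.isMetFunctor_left.op

theorem edist_homEquiv {X : C} {Y : D} (f g : F.obj X ⟶ Y) :
    edist (adj.homEquiv X Y f) (adj.homEquiv X Y g) = edist f g := by
  have symm_nonexpansive (h k : X ⟶ G.obj Y) :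
      edist ((adj.homEquiv X Y).symm h) ((adj.homEquiv X Y).symm k) ≤ edist h k := by
    simp only [adj.homEquiv_counit]
    exact (MetCategory.edist_comp_le_left _ _ _).trans (adj.isMetFunctor_left _ _ h k)
  refine le_antisymm ?_ ?_
  · simp only [adj.homEquiv_unit]
    exact (MetCategory.edist_comp_le_right _ _ _).trans (adj.isMetFunctor_right _ _ f g)
  · simpa only [Equiv.symm_apply_apply] using
      symm_nonexpansive (adj.homEquiv X Y f) (adj.homEquiv X Y g)

/-- The natural bijection of hom-sets, as an isometry. -/
def homIsometry (X : C) (Y : D) : (F.obj X ⟶ Y) ≃ᵢ (X ⟶ G.obj Y) :=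
  ⟨adj.homEquiv X Y, adj.edist_homEquiv⟩

end MetAdjunction

namespace IsPower

theorem exists_iso {P P' X : C} {π : V → (P ⟶ X)} {π' : V → (P' ⟶ X)}
    (h : IsPower V π) (h' : IsPower V π') : ∃ i : P ≅ P', ∀ v, i.hom ≫ π' v = π v := by
  obtain ⟨f, hf, -⟩ := h'.lift P π h.nonexpansive
  obtain ⟨g, hg, -⟩ := h.lift P' π' h'.nonexpansive
  exact ⟨⟨f, g, (h.lift P π h.nonexpansive).unique (fun v => by rw [Category.assoc, hg, hf])
      (fun v => Category.id_comp _),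
    (h'.lift P' π' h'.nonexpansive).unique (fun v => by rw [Category.assoc, hf, hg])
      (fun v => Category.id_comp _)⟩, hf⟩

theorem of_iso {P P' X : C} {π : V → (P ⟶ X)} {π' : V → (P' ⟶ X)}
    (h' : IsPower V π') (i : P ≅ P') (hi : ∀ v, i.hom ≫ π' v = π v) : IsPower V π := by
  obtain rfl : (fun v => i.hom ≫ π' v) = π := funext hi
  refine ⟨fun v w => (MetCategory.edist_comp_le_right _ _ _).trans (h'.nonexpansive v w),
    fun A φ hφ => ?_, fun A g h => ?_⟩
  · obtain ⟨g, hg, hu⟩ := h'.lift A φ hφ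
    refine ⟨g ≫ i.inv, fun v => by simp [hg], fun k hk => ?_⟩
    rw [← hu (k ≫ i.hom) fun v => by simpa using hk v, Category.assoc, i.hom_inv_id,
      Category.comp_id]
  · simp only [← Category.assoc]
    rw [← h'.isometry]
    refine le_antisymm ?_ (MetCategory.edist_comp_le_left _ _ _)
    simpa using MetCategory.edist_comp_le_left (g ≫ i.hom) (h ≫ i.hom) i.inv

theorem comp_isIso {P X Y : C} {π : V → (P ⟶ X)} (h : IsPower V π) (j : X ⟶ Y) [IsIso j] :
    IsPower V (fun v => π v ≫ j) where
  nonexpansive v w := (MetCategory.edist_comp_le_left _ _ j).trans (h.nonexpansive v w)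
  lift A φ hφ := by
    obtain ⟨g, hg, hu⟩ := h.lift A (fun v => φ v ≫ inv j)
      fun v w => (MetCategory.edist_comp_le_left _ _ _).trans (hφ v w)
    exact ⟨g, fun v => by rw [← Category.assoc, hg, Category.assoc, IsIso.inv_hom_id,
      Category.comp_id], fun k hk => hu k fun v => by simp [← hk v]⟩
  isometry A g k := by
    rw [h.isometry]
    refine iSup_congr fun v => le_antisymm ?_ ?_
    · simpa using MetCategory.edist_comp_le_left (g ≫ π v ≫ j) (k ≫ π v ≫ j) (inv j)
    · simpa using MetCategory.edist_comp_le_left (g ≫ π v) (k ≫ π v) j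

theorem isIso_of_comp_eq {P P' X X' : C} {π : V → (P ⟶ X)} {π' : V → (P' ⟶ X')}
    (h : IsPower V π) (h' : IsPower V π') (f : P ⟶ P') (j : X ⟶ X') [IsIso j]
    (hf : ∀ v, f ≫ π' v = π v ≫ j) : IsIso f := by
  obtain ⟨i, hi⟩ := (h.comp_isIso j).exists_iso h'
  obtain rfl : f = i.hom :=
    (h'.lift P _ (h.comp_isIso j).nonexpansive).unique hf hi
  infer_instance

theorem reindex {P X : C} {π : W → (P ⟶ X)} (h : IsPower W π) (e : V ≃ᵢ W) :
    IsPower V (fun v => π (e v)) where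
  nonexpansive v w := (h.nonexpansive (e v) (e w)).trans_eq (e.edist_eq v w)
  lift A φ hφ := by
    obtain ⟨g, hg, hu⟩ := h.lift A (fun w => φ (e.symm w))
      fun w w' => (hφ _ _).trans_eq (e.symm.edist_eq w w')
    refine ⟨g, fun v => by rw [hg, e.symm_apply_apply], fun k hk => hu k fun w => ?_⟩
    rw [← hk, e.apply_symm_apply]
  isometry A g k := (h.isometry A g k).trans (e.toEquiv.iSup_congr fun _ => rfl).symm

theorem of_map {F : C ⥤ D} [F.Full] [F.Faithful]
    (hF : ∀ {X Y : C} (f g : X ⟶ Y), edist (F.map f) (F.map g) = edist f g)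
    {P X : C} {π : V → (P ⟶ X)} (h : IsPower V (fun v => F.map (π v))) : IsPower V π where
  nonexpansive v w := (hF _ _).symm.trans_le (h.nonexpansive v w)
  lift A φ hφ := by
    obtain ⟨g, hg, hu⟩ := h.lift (F.obj A) (fun v => F.map (φ v))
      fun v w => (hF _ _).trans_le (hφ v w)
    obtain ⟨g, rfl⟩ := F.map_surjective g
    exact ⟨g, fun v => F.map_injective ((F.map_comp _ _).trans (hg v)),
      fun k hk => F.map_injective (hu _ fun v => by rw [← F.map_comp, hk])⟩
  isometry A g k := by
    simp only [← hF g k, h.isometry, ← F.map_comp, hF]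

theorem map_rightAdjoint {F : C ⥤ D} {G : D ⥤ C} (adj : MetAdjunction F G) {P X : D}
    {π : V → (P ⟶ X)} (h : IsPower V π) : IsPower V (fun v => G.map (π v)) where
  nonexpansive v w := (adj.isMetFunctor_right _ _ _ _).trans (h.nonexpansive v w)
  lift A φ hφ := by
    obtain ⟨g, hg, hu⟩ := h.lift (F.obj A) (fun v => (adj.homEquiv A X).symm (φ v)) fun v w => by
      rw [← adj.edist_homEquiv, Equiv.apply_symm_apply, Equiv.apply_symm_apply]
      exact hφ v w
    refine ⟨adj.homEquiv A P g, fun v => ?_, fun k hk => ?_⟩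
    · rw [← adj.homEquiv_naturality_right, hg, Equiv.apply_symm_apply]
    · rw [← Equiv.symm_apply_eq]
      exact hu _ fun v => by rw [← adj.homEquiv_naturality_right_symm, hk]
  isometry A g k := by
    obtain ⟨g, rfl⟩ := (adj.homEquiv A P).surjective g
    obtain ⟨k, rfl⟩ := (adj.homEquiv A P).surjective k
    simp only [← adj.homEquiv_naturality_right, adj.edist_homEquiv, h.isometry]

end IsPower

namespace PreservesCountablePowers

theorem of_exists {F : C ⥤ D}
    (h : ∀ (V : Type) [EMetricSpace V] [Countable V] (X : C), ∃ (P : C) (π : V → (P ⟶ X)),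
      IsPower V π ∧ IsPower V (fun v => F.map (π v))) : PreservesCountablePowers F := by
  intro V _ _ P X π hπ
  obtain ⟨P', π', h₁, h₂⟩ := h V X
  obtain ⟨i, hi⟩ := hπ.exists_iso h₁
  exact h₂.of_iso (F.mapIso i) fun v => by rw [← hi v, F.map_comp]; rfl

theorem isPower_map {F : C ⥤ D} (hF : PreservesCountablePowers F) [Countable V] {P X : C}
    {π : V → (P ⟶ X)} (h : IsPower V π) : IsPower V (fun v => F.map (π v)) := by
  let shrink : Shrink.{0} V ≃ V := (equivShrink.{0} V).symm
  let _ : EMetricSpace (Shrink.{0} V) := EMetricSpace.induced shrink shrink.injective inferInstance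
  let e : Shrink.{0} V ≃ᵢ V := ⟨shrink, fun _ _ => rfl⟩
  have := shrink.injective.countable
  simpa using (hF _ _ _ _ (h.reindex e)).reindex e.symm

end PreservesCountablePowers

namespace Met

theorem isPower_of_exists {P X : Met.{u}} {π : V → (P ⟶ X)} (hπ : Nonexpansive π)
    (hex : ∀ φ : NonexpMap V X, ∃ p : P, ∀ v, (π v).toFun p = φ v)
    (hdist : ∀ p q : P, edist p q = ⨆ v, edist ((π v).toFun p) ((π v).toFun q)) :
    IsPower V π where
  nonexpansive := hπ
  lift A φ hφ := by
    have point_ext {p q : P} (h : ∀ v, (π v).toFun p = (π v).toFun q) : p = q :=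
      eq_of_edist_eq_zero (by simp [hdist, h])
    choose g hg using fun a : A => hex ⟨fun v => (φ v).toFun a, fun v w =>
      (NonexpMap.edist_apply_le _ _ a).trans (hφ v w)⟩
    refine ⟨⟨g, fun a b => (hdist _ _).trans_le (iSup_le fun v => ?_)⟩,
      fun v => NonexpMap.ext (funext fun a => hg a v),
      fun k hk => NonexpMap.ext (funext fun a => point_ext fun v => ?_)⟩
    · rw [hg, hg]
      exact (φ v).nonexpansive a b
    · exact (congrArg (fun k => NonexpMap.toFun k a) (hk v)).trans (hg a v).symm
  isometry A g h := (iSup_congr fun a => hdist (g.toFun a) (h.toFun a)).trans iSup_comm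

/-- The point of the one-point space. -/
noncomputable def star : CMet.point.{u}.obj := PUnit.unit

/-- A point of `Y`, as a morphism from the one-point space. -/
noncomputable def point {Y : Met.{u}} (y : Y) : CMet.point.{u}.obj ⟶ Y := NonexpMap.const _ y

theorem edist_eq_edist_star {Y : Met.{u}} (f g : CMet.point.{u}.obj ⟶ Y) :
    edist f g = edist (f.toFun star) (g.toFun star) :=
  le_antisymm (iSup_le fun _ => le_rfl) (NonexpMap.edist_apply_le f g star)

/-- The points of `Y` as morphisms from the one-point space. -/
noncomputable def pointIsometry (Y : Met.{u}) : (CMet.point.{u}.obj ⟶ Y) ≃ᵢ Y where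
  toFun f := f.toFun star
  invFun := point
  left_inv _ := rfl
  right_inv _ := rfl
  isometry_toFun f g := (edist_eq_edist_star f g).symm

/-- An isometric bijection, as an isomorphism. -/
def isoOfIsometryEquiv {X Y : Met.{u}} (e : X ≃ᵢ Y) : X ≅ Y where
  hom := ⟨e, fun x y => (e.edist_eq x y).le⟩
  inv := ⟨e.symm, fun x y => (e.symm.edist_eq x y).le⟩
  hom_inv_id := NonexpMap.ext (funext e.symm_apply_apply)
  inv_hom_id := NonexpMap.ext (funext e.apply_symm_apply)

theorem exists_tuple {P X : Met.{u}} {π : V → (P ⟶ X)} (h : IsPower V π) (φ : NonexpMap V X) :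
    ∃ p : P, ∀ v, (π v).toFun p = φ v := by
  obtain ⟨g, hg, -⟩ := h.lift CMet.point.obj (fun v => point (φ v))
    fun v w => (edist_eq_edist_star _ _).trans_le (φ.nonexpansive v w)
  exact ⟨g.toFun star, fun v => congrArg (fun k => NonexpMap.toFun k star) (hg v)⟩

theorem edist_eq_iSup_of_isPower {P X : Met.{u}} {π : V → (P ⟶ X)} (h : IsPower V π) (p q : P) :
    edist p q = ⨆ v, edist ((π v).toFun p) ((π v).toFun q) := by
  have hpoint := h.isometry CMet.point.obj (point p) (point q)
  simp only [edist_eq_edist_star] at hpoint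
  exact hpoint

end Met

end Powers

section Representable

variable {C : Type u} [Category.{v} C] [MetCategory C]

/-- The enriched Yoneda embedding: the morphisms to an object, as a functor to `Met`. -/
noncomputable def metYoneda : C ⥤ Cᵒᵖ ⥤ Met.{v} where
  obj M :=
    { obj A := ⟨A.unop ⟶ M⟩
      map φ := ⟨fun h => φ.unop ≫ h, fun _ _ => MetCategory.edist_comp_le_right _ _ _⟩
      map_id _ := NonexpMap.ext (funext fun _ => Category.id_comp _)
      map_comp _ _ := NonexpMap.ext (funext fun _ => Category.assoc _ _ _) }
  map g :=
    { app _ := ⟨fun h => h ≫ g, fun _ _ => MetCategory.edist_comp_le_left _ _ _⟩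
      naturality _ _ _ := NonexpMap.ext (funext fun _ => Category.assoc _ _ _) }
  map_id _ := NatTrans.ext (funext fun _ => NonexpMap.ext (funext fun _ => Category.comp_id _))
  map_comp _ _ := NatTrans.ext (funext fun _ =>
    NonexpMap.ext (funext fun _ => (Category.assoc _ _ _).symm))

theorem isMetFunctor_metYoneda_obj (M : C) : IsMetFunctor (metYoneda.obj M) :=
  fun _ _ φ ψ => iSup_le fun h => MetCategory.edist_comp_le_left φ.unop ψ.unop h

theorem IsPower.map_metYoneda {V : Type w} [EMetricSpace V] (M : C) {P X : Cᵒᵖ} {π : V → (P ⟶ X)}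
    (h : IsPower V π) : IsPower V (fun v => (metYoneda.obj M).map (π v)) :=
  Met.isPower_of_exists
    (fun v w => (isMetFunctor_metYoneda_obj M _ _ _ _).trans (h.nonexpansive v w))
    (fun φ => by
      obtain ⟨g, hg, -⟩ := h.lift (op M) (fun v => (φ v).op) φ.nonexpansive
      exact ⟨g.unop, fun v => congrArg Quiver.Hom.unop (hg v)⟩)
    fun p q => h.isometry (op M) p.op q.op

end Representable

/-! ### Tensors -/

/-- The tensor `V ⊗ X` of metric spaces: their product with the sum metric. -/
def MetTensor (V : Type v) (X : Type u) : Type max u v := V × X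

namespace MetTensor

variable {V : Type v} {X : Type u} {A : Type w} [EMetricSpace V] [EMetricSpace X] [EMetricSpace A]

noncomputable instance : EMetricSpace (MetTensor V X) where
  edist p q := edist p.1 q.1 + edist p.2 q.2
  edist_self p := by simp
  edist_comm p q := by simp only [edist_comm]
  edist_triangle p q r := (add_le_add (edist_triangle _ q.1 _) (edist_triangle _ q.2 _)).trans_eq
    (add_add_add_comm _ _ _ _)
  eq_of_edist_eq_zero h := Prod.ext (eq_of_edist_eq_zero (add_eq_zero.1 h).1)
    (eq_of_edist_eq_zero (add_eq_zero.1 h).2)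

theorem edist_def (p q : MetTensor V X) : edist p q = edist p.1 q.1 + edist p.2 q.2 := rfl

instance [Countable V] [Countable X] : Countable (MetTensor V X) :=
  inferInstanceAs (Countable (V × X))

variable (X) in
/-- The inclusion of `X` at a point of `V`. -/
def incl (v : V) : NonexpMap X (MetTensor V X) :=
  ⟨fun x => (v, x), fun x y => (edist_def _ _).trans_le (by simp)⟩

theorem nonexpansive_incl : Nonexpansive (incl X : V → NonexpMap X (MetTensor V X)) :=
  fun v w => iSup_le fun x => (edist_def _ _).trans_le (by simp [incl])

/-- The map out of the tensor given by a nonexpansive family of maps. -/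
def desc (φ : NonexpMap V (NonexpMap X A)) : NonexpMap (MetTensor V X) A where
  toFun p := φ p.1 p.2
  nonexpansive p q := (edist_triangle _ (φ q.1 p.2) _).trans (add_le_add
    (((φ p.1).edist_apply_le (φ q.1) p.2).trans (φ.nonexpansive _ _)) ((φ q.1).nonexpansive _ _))

end MetTensor

namespace Met

/-- The tensor of a metric space by a small metric space. -/
noncomputable def tensor (V : Type) [EMetricSpace V] (X : Met.{u}) : Met.{u} := ⟨MetTensor V X⟩

/-- The inclusion of `X` in `V ⊗ X` at a point of `V`. -/
def tensorIncl {V : Type} [EMetricSpace V] (X : Met.{u}) (v : V) : X ⟶ tensor V X :=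
  MetTensor.incl X v

theorem isPower_op_tensorIncl (V : Type) [EMetricSpace V] (X : Met.{u}) :
    IsPower V (fun v => (tensorIncl X v : X ⟶ tensor V X).op) where
  nonexpansive := MetTensor.nonexpansive_incl
  lift A φ hφ := by
    refine ⟨Quiver.Hom.op (MetTensor.desc ⟨fun v => (φ v).unop, hφ⟩), fun v => rfl, fun g hg => ?_⟩
    refine Quiver.Hom.unop_inj (NonexpMap.ext (funext fun p => ?_))
    exact congrArg (fun k : A ⟶ op X => NonexpMap.toFun k.unop p.2) (hg p.1)
  isometry A g h := le_antisymm
    (iSup_le fun p => le_iSup_of_le p.1 (le_iSup_of_le p.2 le_rfl))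
    (iSup_le fun _ => MetCategory.edist_comp_le_left _ _ _)

theorem exists_isPower_tensor (V : Type) [EMetricSpace V] [Countable V] (X : CMet.{u}) :
    ∃ (P : CMet.{u}) (π : V → (X ⟶ P)), IsPower V fun v => (π v).hom.op := by
  have := X.property
  exact ⟨⟨tensor V X.obj, inferInstanceAs (Countable (MetTensor V X.obj))⟩,
    fun v => ObjectProperty.homMk (tensorIncl X.obj v), isPower_op_tensorIncl V X.obj⟩

theorem isPower_op_point (X : Met.{u}) : IsPower X (fun x : X => (point x).op) where
  nonexpansive x y := (edist_eq_edist_star (point x) (point y)).le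
  lift A φ hφ := by
    refine ⟨Quiver.Hom.op (⟨fun x => (φ x).unop.toFun star, fun x y =>
      (NonexpMap.edist_apply_le _ _ star).trans (hφ x y)⟩ : X ⟶ A.unop), fun x => rfl,
      fun g hg => Quiver.Hom.unop_inj (NonexpMap.ext (funext fun x => ?_))⟩
    exact congrArg (fun k : A ⟶ op CMet.point.obj => NonexpMap.toFun k.unop star) (hg x)
  isometry A g h := iSup_congr fun x =>
    (edist_eq_edist_star (point x ≫ g.unop) (point x ≫ h.unop)).symm

end Met

/-! ### Models of a Lawvere theory -/

namespace MetLawvereTheory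

variable (L : MetLawvereTheory.{u})

/-- The projection of an object to the generator at a point of the corresponding space. -/
noncomputable def proj {X : CMet.{u}} (x : X.obj) : L.functor.obj (op X) ⟶ L.generator :=
  L.functor.map (ObjectProperty.homMk (Met.point x) : CMet.point ⟶ X).op

theorem proj_star : L.proj Met.star = 𝟙 L.generator := L.functor.map_id _

theorem isPower_proj (X : CMet.{u}) : IsPower X.obj (fun x : X.obj => L.proj x) :=
  have := X.property
  L.preservesPowers.isPower_map (π := fun x : X.obj =>
      (ObjectProperty.homMk (Met.point x) : CMet.point ⟶ X).op)
    ((Met.isPower_op_point X.obj).of_map (F := (ObjectProperty.ι _).op) fun _ _ => rfl)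

variable {L} in
theorem isPower_map_proj (N : L.Mod) (X : CMet.{u}) :
    IsPower X.obj (fun x : X.obj => N.obj.map (L.proj x)) :=
  have := X.property
  N.property.2.isPower_map (L.isPower_proj X)

theorem forget_faithful : L.forget.Faithful where
  map_injective {N N'} θ θ' h := by
    refine ObjectProperty.hom_ext _ (NatTrans.ext (funext fun A => ?_))
    obtain ⟨X, rfl⟩ := L.bijective_obj.surjective A
    exact ((isPower_map_proj N' X.unop).lift _ (fun x => N.obj.map (L.proj x) ≫ L.forget.map θ)
      (fun x y => (MetCategory.edist_comp_le_left _ _ _).trans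
        ((isPower_map_proj N X.unop).nonexpansive x y))).unique
      (fun x => (θ.hom.naturality _).symm)
      (fun x => by rw [h]; exact (θ'.hom.naturality _).symm)

theorem forget_reflectsIsomorphisms : L.forget.ReflectsIsomorphisms where
  reflects {N N'} θ isIso_forget := by
    have : IsIso (θ.hom.app L.generator) := isIso_forget
    have isIso_app (A : L.Obj) : IsIso (θ.hom.app A) := by
      obtain ⟨X, rfl⟩ := L.bijective_obj.surjective A
      exact (isPower_map_proj N X.unop).isIso_of_comp_eq (isPower_map_proj N' X.unop)
        (θ.hom.app _) (θ.hom.app L.generator) fun x => (θ.hom.naturality _).symm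
    have := NatIso.isIso_of_isIso_app θ.hom
    have : IsIso ((ObjectProperty.ι _).map θ) := inferInstanceAs (IsIso θ.hom)
    exact isIso_of_reflects_iso θ (ObjectProperty.ι _)

end MetLawvereTheory

/-! ### The Lawvere theory of an enriched adjunction -/

namespace MetAdjunction

variable {C : Type w} [Category.{u} C] [MetCategory C] {F : Met.{u} ⥤ C} {U : C ⥤ Met.{u}}
  (adj : MetAdjunction F U)

variable (F) in
/-- The opposite of the full subcategory of `C` on the images of the countable metric spaces under
`F`. Its objects are the spaces themselves, so that they are not identified when their images
are. -/
abbrev TheoryObj : Type (u + 1) := InducedCategory Cᵒᵖ fun X : CMet.{u} => op (F.obj X.obj)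

variable (F) in
/-- `F`, restricted to countable metric spaces and read contravariantly. -/
noncomputable def toTheory : CMet.{u}ᵒᵖ ⥤ TheoryObj F where
  obj X := X.unop
  map f := InducedCategory.homMk (F.map f.unop.hom).op
  map_id X := InducedCategory.hom_ext (congrArg Quiver.Hom.op (F.map_id X.unop.obj))
  map_comp f g := InducedCategory.hom_ext
    (congrArg Quiver.Hom.op (F.map_comp g.unop.hom f.unop.hom))

/-- The space underlying an object of the theory. -/
abbrev TheoryObj.space (A : TheoryObj F) : Met.{u} := ObjectProperty.FullSubcategory.obj A

include adj in
theorem isPower_toTheory {V : Type v} [EMetricSpace V] {P X : CMet.{u}} (π : V → (X ⟶ P))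
    (h : IsPower V fun v => (π v).hom.op) :
    IsPower V (fun v => (toTheory F).map (π v).op) :=
  (h.map_rightAdjoint adj.op).of_map (F := inducedFunctor fun X : CMet.{u} => op (F.obj X.obj))
    (fun _ _ => rfl)

/-- The Lawvere theory of an enriched adjunction between `Met` and `C`: the opposite of the
category of countably generated free objects of `C`. -/
noncomputable abbrev lawvereTheory : MetLawvereTheory.{u} where
  Obj := TheoryObj F
  functor := toTheory F
  bijective_obj := ⟨Opposite.unop_injective, fun A => ⟨op A, rfl⟩⟩
  enriched _ _ f g := adj.isMetFunctor_left _ _ f.unop.hom g.unop.hom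
  preservesPowers := .of_exists fun V _ _ X => by
    obtain ⟨P, π, hπ⟩ := Met.exists_isPower_tensor V X.unop
    exact ⟨op P, fun v => (π v).op,
      hπ.of_map (F := (ObjectProperty.ι _).op) (fun _ _ => rfl), adj.isPower_toTheory π hπ⟩

/-! ### The nerve -/

/-- The nerve of an object of `C`: its morphisms from the countably generated free objects. -/
noncomputable def nerve : C ⥤ adj.lawvereTheory.Mod where
  obj M :=
    { obj := inducedFunctor _ ⋙ metYoneda.obj M
      property := ⟨fun _ _ φ ψ => isMetFunctor_metYoneda_obj M _ _ φ.hom ψ.hom,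
        .of_exists fun V _ _ X => by
          obtain ⟨P, π, hπ⟩ := Met.exists_isPower_tensor V X
          exact ⟨P, fun v => (toTheory F).map (π v).op, adj.isPower_toTheory π hπ,
            (hπ.map_rightAdjoint adj.op).map_metYoneda M⟩⟩ }
  map g := ObjectProperty.homMk (Functor.whiskerLeft _ (metYoneda.map g))

/-- The points of `U M` are the morphisms to `M` from the free object on one generator. -/
noncomputable def elementIsometry (M : C) : (F.obj CMet.point.obj ⟶ M) ≃ᵢ U.obj M :=
  (adj.homIsometry _ M).trans (Met.pointIsometry _)

theorem elementIsometry_apply {M : C} (h : F.obj CMet.point.obj ⟶ M) :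
    adj.elementIsometry M h =
      (U.map h).toFun ((adj.unit.app CMet.point.obj).toFun Met.star) :=
  congrArg (NonexpMap.toFun · Met.star) (adj.homEquiv_unit _ _ _)

theorem elementIsometry_comp {M N : C} (h : F.obj CMet.point.obj ⟶ M) (g : M ⟶ N) :
    adj.elementIsometry N (h ≫ g) = (U.map g).toFun (adj.elementIsometry M h) :=
  congrArg (NonexpMap.toFun · Met.star) (adj.homEquiv_naturality_right h g)

theorem elementIsometry_symm_comp {M N : C} (m : U.obj M) (g : M ⟶ N) :
    (adj.elementIsometry M).symm m ≫ g = (adj.elementIsometry N).symm ((U.map g).toFun m) := by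
  apply (adj.elementIsometry N).injective
  rw [elementIsometry_comp, IsometryEquiv.apply_symm_apply, IsometryEquiv.apply_symm_apply]

/-- Evaluated at the generator, the nerve of `M` is `U M`. -/
noncomputable def nerveForgetIso : adj.nerve ⋙ adj.lawvereTheory.forget ≅ U :=
  NatIso.ofComponents (fun M => Met.isoOfIsometryEquiv (adj.elementIsometry M))
    fun g => NonexpMap.ext (funext fun h => adj.elementIsometry_comp h g)

theorem nerve_faithful [U.Faithful] : adj.nerve.Faithful :=
  have := Functor.Faithful.of_iso adj.nerveForgetIso.symm
  Functor.Faithful.of_comp adj.nerve adj.lawvereTheory.forget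

/-! ### Elements of free objects as morphisms of the theory -/

/-- The element `p` of the free object on `A`, as a morphism to the generator. -/
noncomputable def elt {A : TheoryObj F} (p : U.obj (F.obj A.space)) :
    A ⟶ adj.lawvereTheory.generator :=
  InducedCategory.homMk ((adj.elementIsometry _).symm p).op

theorem comp_elt {A B : TheoryObj F} (φ : A ⟶ B) (p : U.obj (F.obj B.space)) :
    φ ≫ adj.elt p = adj.elt ((U.map φ.hom.unop).toFun p) :=
  InducedCategory.hom_ext (congrArg Quiver.Hom.op (adj.elementIsometry_symm_comp p φ.hom.unop))

theorem edist_elt {A : TheoryObj F} (p q : U.obj (F.obj A.space)) :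
    edist (adj.elt p) (adj.elt q) = edist p q :=
  (adj.elementIsometry _).symm.edist_eq p q

theorem elt_unit {A : TheoryObj F} (x : A.space) :
    adj.elt ((adj.unit.app A.space).toFun x) = adj.lawvereTheory.proj x := by
  refine InducedCategory.hom_ext (congrArg Quiver.Hom.op ?_)
  rw [IsometryEquiv.symm_apply_eq]
  exact ((adj.elementIsometry_apply _).trans
    (congrArg (NonexpMap.toFun · Met.star) (adj.unit.naturality (Met.point x)).symm)).symm

section Model

variable {N : adj.lawvereTheory.Mod}

/-- The evaluation at `a` of the elements of the free object on `A`. -/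
noncomputable def evalAt {A : TheoryObj F} (a : N.obj.obj A) :
    U.obj (F.obj A.space) ⟶ adj.lawvereTheory.forget.obj N where
  toFun p := (N.obj.map (adj.elt p)).toFun a
  nonexpansive p q := (NonexpMap.edist_apply_le _ _ a).trans
    ((N.property.1 _ _ _ _).trans_eq (adj.edist_elt p q))

theorem evalAt_map {A B : TheoryObj F} (φ : A ⟶ B) (a : N.obj.obj A) :
    adj.evalAt ((N.obj.map φ).toFun a) = U.map φ.hom.unop ≫ adj.evalAt a := by
  refine NonexpMap.ext (funext fun p => ?_)
  change (N.obj.map φ ≫ N.obj.map (adj.elt p)).toFun a = _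
  rw [← N.obj.map_comp, comp_elt]
  rfl

theorem edist_evalAt_le {A : TheoryObj F} (a b : N.obj.obj A) :
    edist (adj.evalAt a) (adj.evalAt b) ≤ edist a b :=
  iSup_le fun p => (N.obj.map (adj.elt p)).nonexpansive a b

theorem evalAt_unit {A : TheoryObj F} (a : N.obj.obj A) (x : A.space) :
    (adj.evalAt a).toFun ((adj.unit.app A.space).toFun x) =
      (N.obj.map (adj.lawvereTheory.proj x)).toFun a :=
  congrArg (fun φ : A ⟶ _ => (N.obj.map φ).toFun a) (adj.elt_unit x)

/-- The universal property of the value at `A` as a power of the value at the generator. -/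
noncomputable def tuple (A : TheoryObj F) :
    (A.space ⟶ adj.lawvereTheory.forget.obj N) ≃ᵢ N.obj.obj A :=
  have isPower := MetLawvereTheory.isPower_map_proj N A
  have unit_evalAt (a : N.obj.obj A) (x : A.space) := adj.evalAt_unit a x
  have isometry (a b : N.obj.obj A) :
      edist (adj.unit.app A.space ≫ adj.evalAt a) (adj.unit.app A.space ≫ adj.evalAt b) =
        edist a b :=
    (iSup_congr fun x => congrArg₂ edist (unit_evalAt a x) (unit_evalAt b x)).trans
      (Met.edist_eq_iSup_of_isPower isPower a b).symm
  (IsometryEquiv.mk (Equiv.ofBijective (fun a : N.obj.obj A => adj.unit.app A.space ≫ adj.evalAt a)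
    ⟨fun a b hab => edist_le_zero.1 ((isometry a b).symm.trans (edist_eq_zero.2 hab)).le,
      fun φ => (Met.exists_tuple isPower φ).imp fun a ha =>
        NonexpMap.ext (funext fun x => (unit_evalAt a x).trans (ha x))⟩) isometry).symm

theorem unit_comp_evalAt_tuple {A : TheoryObj F}
    (φ : A.space ⟶ adj.lawvereTheory.forget.obj N) :
    adj.unit.app A.space ≫ adj.evalAt (adj.tuple A φ) = φ :=
  (adj.tuple A).symm_apply_apply φ

theorem tuple_unit_comp_evalAt {A : TheoryObj F} (a : N.obj.obj A) :
    adj.tuple A (adj.unit.app A.space ≫ adj.evalAt a) = a :=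
  (adj.tuple A).apply_symm_apply a

theorem evalAt_unit_star (a : N.obj.obj adj.lawvereTheory.generator) :
    (adj.evalAt a).toFun ((adj.unit.app CMet.point.obj).toFun Met.star) = a := by
  have map_proj_star : N.obj.map (adj.lawvereTheory.proj Met.star) = 𝟙 _ :=
    (congrArg N.obj.map (MetLawvereTheory.proj_star _)).trans (N.obj.map_id _)
  exact (adj.evalAt_unit (A := adj.lawvereTheory.generator) a Met.star).trans
    (congrArg (NonexpMap.toFun · a) map_proj_star)

end Model

/-- The map on underlying spaces of a transformation of nerves. -/
noncomputable def transfer {M N : C} (θ : adj.nerve.obj M ⟶ adj.nerve.obj N) :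
    U.obj M ⟶ U.obj N :=
  adj.nerveForgetIso.inv.app M ≫ adj.lawvereTheory.forget.map θ ≫ adj.nerveForgetIso.hom.app N

theorem map_app_nerve {M N : C} (θ : adj.nerve.obj M ⟶ adj.nerve.obj N) {A : TheoryObj F}
    (h : F.obj A.space ⟶ M) :
    U.map ((θ.hom.app A).toFun h) = U.map h ≫ adj.transfer θ := by
  refine NonexpMap.ext (funext fun p => ?_)
  let q := (adj.elementIsometry (F.obj A.space)).symm p
  let k : F.obj A.space ⟶ N := (θ.hom.app A).toFun h
  have naturality : q ≫ k = (θ.hom.app _).toFun (q ≫ h) :=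
    congrArg (NonexpMap.toFun · h) (θ.hom.naturality (adj.elt p)).symm
  calc (U.map k).toFun p
      = adj.elementIsometry N (q ≫ k) := by
        rw [elementIsometry_comp, IsometryEquiv.apply_symm_apply]
    _ = adj.elementIsometry N ((θ.hom.app _).toFun (q ≫ h)) := congrArg _ naturality
    _ = (U.map h ≫ adj.transfer θ).toFun p := by
        rw [elementIsometry_symm_comp]
        rfl

theorem nerve_full
    (h : ∀ {M N : C} (t : U.obj M ⟶ U.obj N), (∀ (X : CMet.{u}) (k : F.obj X.obj ⟶ M),
      ∃ l : F.obj X.obj ⟶ N, U.map l = U.map k ≫ t) → ∃ g : M ⟶ N, U.map g = t) :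
    adj.nerve.Full where
  map_surjective {M N} θ := by
    have := MetLawvereTheory.forget_faithful adj.lawvereTheory
    obtain ⟨g, hg⟩ := h (adj.transfer θ) fun X k => ⟨_, adj.map_app_nerve θ k⟩
    refine ⟨g, adj.lawvereTheory.forget.map_injective ?_⟩
    rw [← cancel_epi (adj.nerveForgetIso.inv.app M), ← cancel_mono (adj.nerveForgetIso.hom.app N),
      Category.assoc, Category.assoc]
    exact (NatIso.naturality_1 adj.nerveForgetIso g).trans hg

theorem nerve_essSurj [U.Faithful]
    (h : ∀ N : adj.lawvereTheory.Mod, ∃ (M : C) (i : U.obj M ≅ adj.lawvereTheory.forget.obj N),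
      ∀ {A : TheoryObj F} (a : N.obj.obj A),
        ∃ e : F.obj A.space ⟶ M, U.map e ≫ i.hom = adj.evalAt a) : adj.nerve.EssSurj where
  mem_essImage N := by
    obtain ⟨M, i, hi⟩ := h N
    choose e he using @hi
    have map_e {A : TheoryObj F} (a : N.obj.obj A) : U.map (e a) = adj.evalAt a ≫ i.inv := by
      rw [← he a, Category.assoc, i.hom_inv_id, Category.comp_id]
    have edist_e {A : TheoryObj F} (a b : N.obj.obj A) : edist (e a) (e b) ≤ edist a b := by
      rw [← adj.edist_homEquiv, adj.homEquiv_unit, adj.homEquiv_unit, map_e, map_e]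
      exact (MetCategory.edist_comp_le_right _ _ _).trans
        ((MetCategory.edist_comp_le_left _ _ _).trans (adj.edist_evalAt_le a b))
    let τ : N ⟶ adj.nerve.obj M := ObjectProperty.homMk
      { app A := ⟨e, edist_e⟩
        naturality A B φ := NonexpMap.ext (funext fun a => U.map_injective (by
          change U.map (e _) = U.map (φ.hom.unop ≫ e a)
          rw [U.map_comp, map_e, map_e, ← Category.assoc, ← evalAt_map])) }
    have τ_generator : adj.lawvereTheory.forget.map τ ≫
        adj.nerveForgetIso.hom.app M ≫ i.hom = 𝟙 _ := by
      refine NonexpMap.ext (funext fun (a : N.obj.obj adj.lawvereTheory.generator) => ?_)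
      exact (congrArg i.hom.toFun (adj.elementIsometry_apply (e a))).trans
        ((congrArg (NonexpMap.toFun · _) (he a)).trans (adj.evalAt_unit_star a))
    have : IsIso (adj.lawvereTheory.forget.map τ) := by
      rw [← IsIso.eq_comp_inv, Category.id_comp] at τ_generator
      rw [τ_generator]
      infer_instance
    have := MetLawvereTheory.forget_reflectsIsomorphisms adj.lawvereTheory
    have := isIso_of_reflects_iso τ adj.lawvereTheory.forget
    exact ⟨M, ⟨(asIso τ).symm⟩⟩

end MetAdjunction

/-! ### Classes of structures -/

namespace SigModel

variable {Ω : MetricSignature.{u}}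

noncomputable instance : MetCategory (SigModel Ω) where
  homMetric M N := EMetricSpace.induced (fun φ : M ⟶ N => φ.map) (fun _ _ => Hom.ext)
    inferInstance
  edist_comp_le φ φ' ψ ψ' := MetCategory.edist_comp_le φ.map φ'.map ψ.map ψ'.map

/-- `F` is separated by the class `P` if the homomorphisms from `F` to the members of `P` are
jointly isometric. -/
def SeparatedBy (P : ObjectProperty (SigModel Ω)) (F : SigModel Ω) : Prop :=
  ∀ (p q : F.space) (r : ℝ≥0∞),
    (∀ M, P M → ∀ φ : F ⟶ M, edist (φ.map.toFun p) (φ.map.toFun q) ≤ r) → edist p q ≤ r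

/-- `M` is countably covered by the class `P` if every nonexpansive map from a countable space
to `M` factors through a homomorphism from a member of `P`. -/
def CountablyCoveredBy (P : ObjectProperty (SigModel Ω)) (M : SigModel Ω) : Prop :=
  ∀ (X : Type u) [EMetricSpace X] [Countable X] (a : NonexpMap X M.space),
    ∃ K, P K ∧ ∃ (φ : K ⟶ M) (b : NonexpMap X K.space), NonexpMap.comp φ.map b = a

/-- A class of structures that contains the structures which it separates; such a class has free
objects. -/
class ClosedUnderSeparation (P : ObjectProperty (SigModel Ω)) : Prop where
  of_separatedBy {F : SigModel Ω} : SeparatedBy P F → P F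

/-- A class of structures that contains the structures which it countably covers; such a class is
closed under countably filtered colimits. -/
class ClosedUnderCountableCovers (P : ObjectProperty (SigModel Ω)) : Prop where
  of_countablyCoveredBy {M : SigModel Ω} : CountablyCoveredBy P M → P M

/-! ### Satisfaction of judgments -/

/-- The class of the structures that satisfy a set of judgments. -/
def satisfying (S : Set (MetJudgment Ω)) : ObjectProperty (SigModel Ω) :=
  fun M => ∀ j ∈ S, M.Satisfies j

section Satisfaction

variable {X : Type v}

/-- The image of an assignment under a homomorphism. -/
def Hom.assign {M N : SigModel Ω} (φ : M ⟶ N) {Γ : MetContext X} (α : Γ.Assign M.space) :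
    Γ.Assign N.space :=
  ⟨fun x => φ.map.toFun (α.1 x), fun e he => (φ.map.nonexpansive _ _).trans (α.2 e he)⟩

theorem Hom.map_interp {M N : SigModel Ω} (φ : M ⟶ N) (Γ : MetContext X) (α : Γ.Assign M.space) :
    ∀ (t : Preterm Ω X) (hM : (M.interp Γ t).Dom) (hN : (N.interp Γ t).Dom),
      φ.map.toFun ((M.interp Γ t).get hM α) = (N.interp Γ t).get hN (Hom.assign φ α)
  | .var _, _, _ => rfl
  | .app f t, hM, hN => (φ.map_op f _).trans <| congrArg (N.op f) <| NonexpMap.ext <|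
      funext fun i => map_interp φ Γ α (t i) (hM.1 i) (hN.1 i)

variable {P : ObjectProperty (SigModel Ω)}

theorem SeparatedBy.interp_dom {F : SigModel Ω} (hF : SeparatedBy P F) (Γ : MetContext X)
    (t : Preterm Ω X) (ht : ∀ M, P M → (M.interp Γ t).Dom) : (F.interp Γ t).Dom := by
  induction t with
  | var x => trivial
  | app f t ih =>
    refine ⟨fun i => ih i fun M hM => (ht M hM).1 i, fun i j α => hF _ _ _ fun M hM φ => ?_⟩
    rw [Hom.map_interp φ Γ α (t i) _ ((ht M hM).1 i), Hom.map_interp φ Γ α (t j) _ ((ht M hM).1 j)]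
    exact (ht M hM).2 i j _

instance (S : Set (MetJudgment Ω)) : ClosedUnderSeparation (satisfying S) where
  of_separatedBy {F} hF j hj := by
    cases j with
    | ok Γ t => exact hF.interp_dom Γ t fun M hM => hM _ hj
    | eq Γ s t ε =>
      refine ⟨hF.interp_dom Γ s fun M hM => (hM _ hj).1,
        hF.interp_dom Γ t fun M hM => (hM _ hj).2.1, fun α => hF _ _ _ fun M hM φ => ?_⟩
      obtain ⟨hs, ht, h⟩ := hM _ hj
      rw [Hom.map_interp φ Γ α s _ hs, Hom.map_interp φ Γ α t _ ht]
      exact h _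

theorem CountablyCoveredBy.exists_assign [Countable X] {M : SigModel Ω}
    (hM : CountablyCoveredBy P M) {Γ : MetContext X} (α : Γ.Assign M.space) :
    ∃ K, P K ∧ ∃ (φ : K ⟶ M) (β : Γ.Assign K.space), Hom.assign φ β = α := by
  have := (Set.countable_range α.1).to_subtype
  let values : NonexpMap (Set.range α.1) M.space := ⟨Subtype.val, fun _ _ => le_rfl⟩
  obtain ⟨K, hK, φ, b, hb⟩ := hM _ values
  refine ⟨K, hK, φ, ⟨fun x => b ⟨α.1 x, x, rfl⟩, fun e he =>
    (b.nonexpansive _ _).trans (α.2 e he)⟩, Subtype.ext (funext fun x => ?_)⟩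
  exact congrArg (fun c => NonexpMap.toFun c ⟨α.1 x, x, rfl⟩) hb

theorem CountablyCoveredBy.interp_dom [Countable X] {M : SigModel Ω}
    (hM : CountablyCoveredBy P M) (Γ : MetContext X) (t : Preterm Ω X)
    (ht : ∀ K, P K → (K.interp Γ t).Dom) : (M.interp Γ t).Dom := by
  induction t with
  | var x => trivial
  | app f t ih =>
    refine ⟨fun i => ih i fun K hK => (ht K hK).1 i, fun i j α => ?_⟩
    obtain ⟨K, hK, φ, β, rfl⟩ := hM.exists_assign α
    rw [← Hom.map_interp φ Γ β (t i) ((ht K hK).1 i), ← Hom.map_interp φ Γ β (t j) ((ht K hK).1 j)]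
    exact (φ.map.nonexpansive _ _).trans ((ht K hK).2 i j β)

instance (S : Set (MetJudgment Ω)) : ClosedUnderCountableCovers (satisfying S) where
  of_countablyCoveredBy {M} hM j hj := by
    cases j with
    | ok Γ t => exact hM.interp_dom Γ t fun K hK => hK _ hj
    | eq Γ s t ε =>
      refine ⟨hM.interp_dom Γ s fun K hK => (hK _ hj).1,
        hM.interp_dom Γ t fun K hK => (hK _ hj).2.1, fun α => ?_⟩
      obtain ⟨K, hK, φ, β, rfl⟩ := hM.exists_assign α
      obtain ⟨hs, ht, h⟩ := hK _ hj
      rw [← Hom.map_interp φ Γ β s hs, ← Hom.map_interp φ Γ β t ht]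
      exact (φ.map.nonexpansive _ _).trans (h β)

end Satisfaction

/-! ### Evaluation of preterms -/

/-- The relation "the preterm `t` has the value `a` at the assignment `h`". Unlike `interp`, it
refers to a single assignment and to no context. -/
inductive Eval (M : SigModel Ω) {X : Type v} (h : X → M.space) : Preterm Ω X → M.space → Prop
  | var (x : X) : Eval M h (.var x) (h x)
  | app (f : Ω.Op) (t : Ω.arity f → Preterm Ω X) (a : NonexpMap (Ω.arity f) M.space) :
      (∀ i, Eval M h (t i) (a i)) → Eval M h (.app f t) (M.op f a)

theorem Eval.unique {M : SigModel Ω} {X : Type v} {h : X → M.space} {t : Preterm Ω X}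
    {a b : M.space} (ha : Eval M h t a) (hb : Eval M h t b) : a = b := by
  induction ha generalizing b with
  | var x => cases hb; rfl
  | app f t a _ ih =>
    obtain - | ⟨_, _, a', ha'⟩ := hb
    exact congrArg (M.op f) (NonexpMap.ext (funext fun i => ih i (ha' i)))

theorem Eval.exists_args {M : SigModel Ω} {X : Type v} {h : X → M.space} {f : Ω.Op}
    {t : Ω.arity f → Preterm Ω X} {a : M.space} (ha : Eval M h (.app f t) a) :
    ∃ b : NonexpMap (Ω.arity f) M.space, ∀ i, Eval M h (t i) (b i) := by
  obtain - | ⟨_, _, b, hb⟩ := ha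
  exact ⟨b, hb⟩

end SigModel

/-! ### Free models -/

namespace SigModel

variable {Ω : MetricSignature.{u}} (P : ObjectProperty (SigModel Ω)) (X : Met.{u})

/-- The forgetful functor of a class of structures. -/
abbrev forgetOn : P.FullSubcategory ⥤ Met.{u} := P.ι ⋙ forget Ω

instance : (forgetOn P).Faithful where
  map_injective h := ObjectProperty.hom_ext P (Hom.ext h)

/-- A member of `P` together with an interpretation in it of the variables in `X`. -/
abbrev Valuation : Type (u + 1) := Σ M : P.FullSubcategory, X ⟶ M.obj.space

/-- The preterms over `X` that have a value at each valuation. -/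
def FreeTerm : Type u := {t : Preterm Ω X // ∀ v : Valuation P X, ∃ a, v.1.obj.Eval v.2.toFun t a}

namespace FreeTerm

variable {P X}

/-- The value of a term at a valuation. -/
noncomputable def eval (v : Valuation P X) (t : FreeTerm P X) : v.1.obj.space := (t.2 v).choose

theorem eval_spec (v : Valuation P X) (t : FreeTerm P X) :
    v.1.obj.Eval v.2.toFun t.1 (eval v t) :=
  (t.2 v).choose_spec

theorem eval_eq {v : Valuation P X} {t : FreeTerm P X} {a : v.1.obj.space}
    (ha : v.1.obj.Eval v.2.toFun t.1 a) : eval v t = a :=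
  (eval_spec v t).unique ha

noncomputable instance : PseudoEMetricSpace (FreeTerm P X) where
  edist s t := ⨆ v, edist (eval v s) (eval v t)
  edist_self s := by simp
  edist_comm s t := by simp only [edist_comm]
  edist_triangle s t r := iSup_le fun v => (edist_triangle _ (eval v t) _).trans
    (add_le_add (le_iSup (fun v => edist (eval v s) (eval v t)) v)
      (le_iSup (fun v => edist (eval v t) (eval v r)) v))

theorem edist_eval_le (v : Valuation P X) (s t : FreeTerm P X) :
    edist (eval v s) (eval v t) ≤ edist s t :=
  le_iSup (fun v => edist (eval v s) (eval v t)) v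

variable (P) in
/-- A variable as a term. -/
def var (x : X) : FreeTerm P X := ⟨.var x, fun v => ⟨v.2.toFun x, .var x⟩⟩

/-- An operation applied to a nonexpansive family of terms. -/
def app (f : Ω.Op) (t : Ω.arity f → FreeTerm P X) (ht : ∀ i j, edist (t i) (t j) ≤ edist i j) :
    FreeTerm P X :=
  ⟨.app f fun i => (t i).1, fun v => ⟨_, .app f _ ⟨fun i => eval v (t i), fun i j =>
    (edist_eval_le v _ _).trans (ht i j)⟩ fun i => eval_spec v (t i)⟩⟩

end FreeTerm

/-- The points of the free model on `X`: the terms, up to having the same values. -/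
abbrev FreeSpace : Type u := SeparationQuotient (FreeTerm P X)

namespace FreeSpace

variable {P X}

/-- The value of a point of the free model at a valuation. -/
noncomputable def eval (v : Valuation P X) : FreeSpace P X → v.1.obj.space :=
  SeparationQuotient.lift (FreeTerm.eval v) fun s t hst =>
    edist_le_zero.1 ((FreeTerm.edist_eval_le v s t).trans_eq hst.edist_eq_zero)

theorem edist_eval_le (v : Valuation P X) (p q : FreeSpace P X) :
    edist (eval v p) (eval v q) ≤ edist p q := by
  obtain ⟨s, rfl⟩ := SeparationQuotient.surjective_mk p
  obtain ⟨t, rfl⟩ := SeparationQuotient.surjective_mk q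
  exact (FreeTerm.edist_eval_le v s t).trans_eq (SeparationQuotient.edist_mk s t).symm

theorem edist_le {p q : FreeSpace P X} {r : ℝ≥0∞}
    (h : ∀ v : Valuation P X, edist (eval v p) (eval v q) ≤ r) : edist p q ≤ r := by
  obtain ⟨s, rfl⟩ := SeparationQuotient.surjective_mk p
  obtain ⟨t, rfl⟩ := SeparationQuotient.surjective_mk q
  exact (SeparationQuotient.edist_mk s t).trans_le (iSup_le h)

theorem eval_ext {p q : FreeSpace P X} (h : ∀ v : Valuation P X, eval v p = eval v q) : p = q :=
  edist_le_zero.1 (edist_le fun v => (edist_eq_zero.2 (h v)).le)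

theorem mk_out (p : FreeSpace P X) :
    SeparationQuotient.mk (Quotient.out p : FreeTerm P X) = p :=
  Quotient.out_eq p

/-- The operations of the free model. -/
noncomputable def op (f : Ω.Op) (a : NonexpMap (Ω.arity f) (FreeSpace P X)) : FreeSpace P X :=
  SeparationQuotient.mk (FreeTerm.app f (fun i => Quotient.out (a i)) fun i j => by
    rw [← SeparationQuotient.edist_mk, mk_out, mk_out]
    exact a.nonexpansive i j)

theorem eval_op (v : Valuation P X) (f : Ω.Op) (a : NonexpMap (Ω.arity f) (FreeSpace P X)) :
    eval v (op f a) = v.1.obj.op f (NonexpMap.comp ⟨eval v, edist_eval_le v⟩ a) :=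
  FreeTerm.eval_eq <| .app f _ _ fun i =>
    (congrArg (Eval _ _ _) (congrArg (eval v) (mk_out (a i)))).mp (FreeTerm.eval_spec v _)

theorem exists_op_eq_mk_app {f : Ω.Op} {t : Ω.arity f → Preterm Ω X}
    (h : ∀ v : Valuation P X, ∃ a, v.1.obj.Eval v.2.toFun (.app f t) a) :
    ∃ (s : Ω.arity f → FreeTerm P X) (a : NonexpMap (Ω.arity f) (FreeSpace P X)),
      (∀ i, (s i).1 = t i) ∧ (∀ i, a i = SeparationQuotient.mk (s i)) ∧
        op f a = SeparationQuotient.mk ⟨.app f t, h⟩ := by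
  choose b hb using fun v => (h v).choose_spec.exists_args
  let s (i : Ω.arity f) : FreeTerm P X := ⟨t i, fun v => ⟨b v i, hb v i⟩⟩
  have eval_s (v : Valuation P X) (i : Ω.arity f) : FreeTerm.eval v (s i) = b v i :=
    FreeTerm.eval_eq (hb v i)
  let a : NonexpMap (Ω.arity f) (FreeSpace P X) := ⟨fun i => SeparationQuotient.mk (s i),
    fun i j => edist_le fun v => by
      change edist (FreeTerm.eval v (s i)) (FreeTerm.eval v (s j)) ≤ _
      rw [eval_s, eval_s]
      exact (b v).nonexpansive i j⟩
  refine ⟨s, a, fun _ => rfl, fun _ => rfl, eval_ext fun v => ?_⟩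
  calc eval v (op f a)
      = v.1.obj.op f (NonexpMap.comp ⟨eval v, edist_eval_le v⟩ a) := eval_op v f a
    _ = v.1.obj.op f (b v) := congrArg _ (NonexpMap.ext (funext (eval_s v)))
    _ = FreeTerm.eval v ⟨.app f t, h⟩ := (FreeTerm.eval_eq (.app f t _ (hb v))).symm

end FreeSpace

/-- The free model of the class `P` on `X`. -/
noncomputable def free : SigModel Ω where
  space := ⟨FreeSpace P X⟩
  op f := ⟨FreeSpace.op f, fun a b => FreeSpace.edist_le fun v => by
    rw [FreeSpace.eval_op, FreeSpace.eval_op]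
    exact ((v.1.obj.op f).nonexpansive _ _).trans
      (iSup_mono fun i => FreeSpace.edist_eval_le v _ _)⟩

/-- The inclusion of the generators. -/
noncomputable def unit : X ⟶ (free P X).space where
  toFun x := SeparationQuotient.mk (FreeTerm.var P x)
  nonexpansive x y := FreeSpace.edist_le fun v => by
    change edist (FreeTerm.eval v (FreeTerm.var P x)) (FreeTerm.eval v (FreeTerm.var P y)) ≤ _
    rw [FreeTerm.eval_eq (.var x), FreeTerm.eval_eq (.var y)]
    exact v.2.nonexpansive x y

variable {P X}

/-- The extension of a valuation to the free model. -/
noncomputable def lift (v : Valuation P X) : free P X ⟶ v.1.obj where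
  map := ⟨FreeSpace.eval v, FreeSpace.edist_eval_le v⟩
  map_op f a := FreeSpace.eval_op v f a

theorem unit_lift (v : Valuation P X) : unit P X ≫ (lift v).map = v.2 :=
  NonexpMap.ext (funext fun x => FreeTerm.eval_eq (.var x))

theorem free_induction {Q : (free P X).space → Prop} (unit : ∀ x, Q ((unit P X).toFun x))
    (op : ∀ (f : Ω.Op) (a : NonexpMap (Ω.arity f) (free P X).space),
      (∀ i, Q (a i)) → Q ((free P X).op f a)) (p : (free P X).space) : Q p := by
  obtain ⟨⟨t, ht⟩, rfl⟩ := SeparationQuotient.surjective_mk p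
  induction t with
  | var x => exact unit x
  | app f t ih =>
    obtain ⟨s, a, hs, ha, op_eq⟩ := FreeSpace.exists_op_eq_mk_app ht
    obtain rfl : (fun i => (s i).1) = t := funext hs
    rw [← op_eq]
    exact op f a fun i => by rw [ha]; exact ih i (s i).2

theorem edist_hom_le {M : SigModel Ω} (φ ψ : free P X ⟶ M) :
    edist φ ψ ≤ edist (unit P X ≫ φ.map) (unit P X ≫ ψ.map) := by
  refine iSup_le fun p => ?_
  induction p using free_induction with
  | unit x => exact NonexpMap.edist_apply_le (unit P X ≫ φ.map) (unit P X ≫ ψ.map) x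
  | op f a ih =>
    rw [φ.map_op, ψ.map_op]
    exact ((M.op f).nonexpansive _ _).trans (iSup_le ih)

theorem free_hom_ext {M : SigModel Ω} {φ ψ : free P X ⟶ M}
    (h : unit P X ≫ φ.map = unit P X ≫ ψ.map) : φ = ψ :=
  edist_le_zero.1 ((edist_hom_le φ ψ).trans (edist_eq_zero.2 h).le)

variable (P X) [ClosedUnderSeparation P]

/-- The free model, as a member of the class. -/
noncomputable def freeModel : P.FullSubcategory where
  obj := free P X
  property := ClosedUnderSeparation.of_separatedBy fun _ _ _ h =>
    FreeSpace.edist_le fun v => h v.1.obj v.1.property (lift v)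

variable {X} in
/-- The universal property of the free model. -/
noncomputable def freeEquiv (M : P.FullSubcategory) :
    (freeModel P X ⟶ M) ≃ (X ⟶ M.obj.space) where
  toFun φ := unit P X ≫ φ.hom.map
  invFun h := ObjectProperty.homMk (lift ⟨M, h⟩)
  left_inv _ := ObjectProperty.hom_ext P (free_hom_ext (unit_lift _))
  right_inv h := unit_lift ⟨M, h⟩

/-- The free model functor. -/
noncomputable def freeFunctor : Met.{u} ⥤ P.FullSubcategory :=
  Adjunction.leftAdjointOfEquiv (G := forgetOn P) (fun _ M => freeEquiv P M) fun _ _ _ _ _ => rfl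

/-- The adjunction between the free model functor and the forgetful functor. -/
noncomputable def freeAdjunction : MetAdjunction (freeFunctor P) (forgetOn P) where
  toAdjunction := Adjunction.adjunctionOfEquivLeft _ _
  isMetFunctor_left X Y f g := by
    have unit_map (h : X ⟶ Y) : unit P X ≫ ((freeFunctor P).map h).hom.map = h ≫ unit P Y :=
      unit_lift ⟨freeModel P Y, h ≫ unit P Y⟩
    refine (edist_hom_le _ _).trans ?_
    rw [unit_map, unit_map]
    exact MetCategory.edist_comp_le_left f g _
  isMetFunctor_right _ _ _ _ := le_rfl

end SigModel

/-! ### Countably filtered colimits of metric spaces -/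

section CommonStage

open Limits

variable {J : Type u} [Category.{v} J]

theorem hasCardinalLT_aleph_one (ι : Type w) [Countable ι] :
    HasCardinalLT ι (ℵ₁ : Cardinal.{u}) := by
  rw [HasCardinalLT, Cardinal.lift_aleph, Ordinal.lift_one, Cardinal.lt_aleph_one_iff,
    Cardinal.lift_le_aleph0]
  exact Cardinal.mk_le_aleph0

instance isFiltered_of_aleph_one [IsCardinalFiltered J (ℵ₁ : Cardinal.{u})] : IsFiltered J :=
  isFiltered_of_isCardinalFiltered J (ℵ₁ : Cardinal.{u})

theorem exists_common_stage {κ : Cardinal.{u}} [Fact κ.IsRegular] [IsCardinalFiltered J κ]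
    {ι : Type w} (hι : HasCardinalLT ι κ) {j : J} (p : ι → ∀ l, (j ⟶ l) → Prop)
    (hp : ∀ i l m (f : j ⟶ l) (g : l ⟶ m), p i l f → p i m (f ≫ g))
    (h : ∀ i, ∃ l f, p i l f) : ∃ l f, ∀ i, p i l f := by
  choose l f hf using h
  obtain ⟨m, a, b, fa_eq⟩ := IsCardinalFiltered.wideSpan f hι
  exact ⟨m, b, fun i => fa_eq i ▸ hp i _ _ _ (a i) (hf i)⟩

end CommonStage

namespace Met

open Limits

variable {J : Type u} [Category.{v} J] {G : J ⥤ Met.{u}}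

theorem map_comp_apply {l m n : J} (f : l ⟶ m) (g : m ⟶ n) (x : G.obj l) :
    (G.map (f ≫ g)).toFun x = (G.map g).toFun ((G.map f).toFun x) := by
  rw [G.map_comp]; rfl

theorem cocone_apply (s : Cocone G) {j l : J} (f : j ⟶ l) (x : G.obj j) :
    (s.ι.app l).toFun ((G.map f).toFun x) = (s.ι.app j).toFun x :=
  congrArg (fun φ : G.obj j ⟶ s.pt => φ.toFun x) (s.w f)

theorem edist_map_comp_le {j l m : J} (f : j ⟶ l) (g : l ⟶ m) (x y : G.obj j) :
    edist ((G.map (f ≫ g)).toFun x) ((G.map (f ≫ g)).toFun y) ≤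
      edist ((G.map f).toFun x) ((G.map f).toFun y) := by
  rw [map_comp_apply, map_comp_apply]
  exact (G.map g).nonexpansive _ _

variable (G) in
/-- The points of all the spaces of the diagram `G`, which represent the points of its colimit. -/
def PreColim : Type u := Σ j, (G.obj j : Type u)

variable [IsFiltered J]

/-- The distance of two points is the infimum of their distances at all later stages. -/
noncomputable instance : PseudoEMetricSpace (PreColim G) where
  edist x y := ⨅ (l) (f : x.1 ⟶ l) (g : y.1 ⟶ l), edist ((G.map f).toFun x.2) ((G.map g).toFun y.2)
  edist_self x := le_antisymm (iInf_le_of_le x.1 (iInf₂_le_of_le (𝟙 _) (𝟙 _) (by simp))) zero_le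
  edist_comm x y := by
    simp only [edist_comm]
    exact iInf_congr fun l => iInf_comm
  edist_triangle x y z := by
    simp only [ENNReal.iInf_add, ENNReal.add_iInf]
    refine le_iInf fun l => le_iInf₂ fun f g => le_iInf fun l' => le_iInf₂ fun f' g' => ?_
    obtain ⟨m, a, b, ga_eq_fb⟩ := IsFiltered.span g' f
    calc ⨅ (l) (f : x.1 ⟶ l) (g : z.1 ⟶ l), edist ((G.map f).toFun x.2) ((G.map g).toFun z.2)
        ≤ edist ((G.map (f' ≫ a)).toFun x.2) ((G.map (g ≫ b)).toFun z.2) :=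
          iInf_le_of_le m (iInf₂_le_of_le (f' ≫ a) (g ≫ b) le_rfl)
      _ ≤ edist ((G.map (f' ≫ a)).toFun x.2) ((G.map (g' ≫ a)).toFun y.2) +
            edist ((G.map (f ≫ b)).toFun y.2) ((G.map (g ≫ b)).toFun z.2) := by
          rw [← ga_eq_fb]
          exact edist_triangle _ _ _
      _ ≤ edist ((G.map f').toFun x.2) ((G.map g').toFun y.2) +
            edist ((G.map f).toFun y.2) ((G.map g).toFun z.2) := by
          simp only [map_comp_apply]
          exact add_le_add ((G.map a).nonexpansive _ _) ((G.map b).nonexpansive _ _)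

variable (G) in
/-- The colimit of a filtered diagram of metric spaces. -/
noncomputable def filteredColim : Met.{u} := ⟨SeparationQuotient (PreColim G)⟩

namespace filteredColim

variable (G) in
/-- The maps into the colimit. -/
noncomputable def incl (j : J) : G.obj j ⟶ filteredColim G where
  toFun x := SeparationQuotient.mk (⟨j, x⟩ : PreColim G)
  nonexpansive x y := (SeparationQuotient.edist_mk _ _).trans_le
    (iInf_le_of_le j (iInf₂_le_of_le (𝟙 _) (𝟙 _) (by simp only [G.map_id]; exact le_rfl)))

theorem incl_surjective (p : filteredColim G) : ∃ j x, (incl G j).toFun x = p := by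
  obtain ⟨⟨j, x⟩, rfl⟩ := SeparationQuotient.surjective_mk p
  exact ⟨j, x, rfl⟩

theorem edist_incl {j k : J} (x : G.obj j) (y : G.obj k) :
    edist ((incl G j).toFun x) ((incl G k).toFun y) =
      ⨅ (l) (f : j ⟶ l) (g : k ⟶ l), edist ((G.map f).toFun x) ((G.map g).toFun y) :=
  SeparationQuotient.edist_mk _ _

theorem incl_map {j k : J} (f : j ⟶ k) (x : G.obj j) :
    (incl G k).toFun ((G.map f).toFun x) = (incl G j).toFun x := by
  refine edist_le_zero.1 ((edist_incl _ _).trans_le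
    (iInf_le_of_le k (iInf₂_le_of_le (𝟙 _) f ?_)))
  rw [G.map_id]
  exact (edist_self _).le

theorem exists_edist_lt {j : J} {x y : G.obj j} {r : ℝ≥0∞}
    (h : edist ((incl G j).toFun x) ((incl G j).toFun y) < r) :
    ∃ (l : J) (f : j ⟶ l), edist ((G.map f).toFun x) ((G.map f).toFun y) < r := by
  simp only [edist_incl, iInf_lt_iff] at h
  obtain ⟨l, f, g, hfg⟩ := h
  let c := IsFiltered.coeqHom f g
  refine ⟨_, f ≫ c, lt_of_le_of_lt ?_ hfg⟩
  calc edist ((G.map (f ≫ c)).toFun x) ((G.map (f ≫ c)).toFun y)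
      = edist ((G.map (f ≫ c)).toFun x) ((G.map (g ≫ c)).toFun y) := by
        rw [IsFiltered.coeq_condition f g]
    _ ≤ edist ((G.map f).toFun x) ((G.map g).toFun y) := by
        rw [map_comp_apply, map_comp_apply]
        exact (G.map c).nonexpansive _ _

variable (G) in
/-- The colimit cocone. -/
noncomputable def cocone : Cocone G where
  pt := filteredColim G
  ι :=
    { app := incl G
      naturality := fun _ _ f => NonexpMap.ext (funext fun x => incl_map f x) }

theorem edist_cocone_le (s : Cocone G) (x y : PreColim G) :
    edist ((s.ι.app x.1).toFun x.2) ((s.ι.app y.1).toFun y.2) ≤ edist x y :=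
  le_iInf fun l => le_iInf₂ fun f g => by
    rw [← cocone_apply s f, ← cocone_apply s g]
    exact (s.ι.app l).nonexpansive _ _

/-- The map out of the colimit that a cocone induces. -/
noncomputable def desc (s : Cocone G) : filteredColim G ⟶ s.pt where
  toFun := SeparationQuotient.lift (fun x : PreColim G => (s.ι.app x.1).toFun x.2)
    fun x y hxy => edist_le_zero.1 ((edist_cocone_le s x y).trans_eq hxy.edist_eq_zero)
  nonexpansive p q := by
    obtain ⟨x, rfl⟩ := SeparationQuotient.surjective_mk p
    obtain ⟨y, rfl⟩ := SeparationQuotient.surjective_mk q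
    exact (edist_cocone_le s x y).trans (SeparationQuotient.edist_mk _ _).ge

variable (G) in
/-- The universal property of the colimit. -/
noncomputable def isColimit : IsColimit (cocone G) where
  desc := desc
  fac _ _ := rfl
  uniq s m h := NonexpMap.ext (funext fun p => by
    obtain ⟨j, x, rfl⟩ := incl_surjective p
    exact congrArg (fun φ : G.obj j ⟶ s.pt => φ.toFun x) (h j))

end filteredColim

end Met

namespace Met.filteredColim

open Limits

variable {J : Type u} [Category.{v} J] [IsCardinalFiltered J (ℵ₁ : Cardinal.{u})] {G : J ⥤ Met.{u}}

theorem exists_edist_le {j : J} {x y : G.obj j} {r : ℝ≥0∞}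
    (h : edist ((incl G j).toFun x) ((incl G j).toFun y) ≤ r) :
    ∃ (l : J) (f : j ⟶ l), edist ((G.map f).toFun x) ((G.map f).toFun y) ≤ r := by
  obtain rfl | r_lt_top := eq_top_or_lt_top r
  · exact ⟨j, 𝟙 _, le_top⟩
  obtain ⟨u, -, hu, u_tendsto⟩ := exists_seq_strictAnti_tendsto' r_lt_top
  obtain ⟨l, f, hf⟩ := exists_common_stage (hasCardinalLT_aleph_one ℕ) (j := j)
    (fun n _ f => edist ((G.map f).toFun x) ((G.map f).toFun y) ≤ u n)
    (fun _ _ _ f g => (edist_map_comp_le f g x y).trans)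
    fun n => by
      obtain ⟨l, f, hf⟩ := exists_edist_lt (h.trans_lt (hu n).1)
      exact ⟨l, f, hf.le⟩
  exact ⟨l, f, ge_of_tendsto' u_tendsto hf⟩

theorem exists_forall_edist_le {ι : Type w} [Countable ι] {j : J} (x y : ι → G.obj j)
    (r : ι → ℝ≥0∞) (h : ∀ i, edist ((incl G j).toFun (x i)) ((incl G j).toFun (y i)) ≤ r i) :
    ∃ (l : J) (f : j ⟶ l), ∀ i, edist ((G.map f).toFun (x i)) ((G.map f).toFun (y i)) ≤ r i :=
  exists_common_stage (hasCardinalLT_aleph_one ι)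
    (fun i _ f => edist ((G.map f).toFun (x i)) ((G.map f).toFun (y i)) ≤ r i)
    (fun i _ _ f g => (edist_map_comp_le f g (x i) (y i)).trans)
    fun i => exists_edist_le (h i)

theorem exists_lift {N : Type w} [EMetricSpace N] [Countable N]
    (a : NonexpMap N (filteredColim G)) :
    ∃ (j : J) (b : NonexpMap N (G.obj j)), NonexpMap.comp (incl G j) b = a := by
  choose j x hx using fun n => incl_surjective (a n)
  let m := IsCardinalFiltered.max j (hasCardinalLT_aleph_one.{u} N)
  let y (n : N) : G.obj m :=
    (G.map (IsCardinalFiltered.toMax j (hasCardinalLT_aleph_one.{u} N) n)).toFun (x n)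
  have incl_y (n : N) : (incl G m).toFun (y n) = a n := (incl_map _ _).trans (hx n)
  obtain ⟨l, f, hf⟩ := exists_forall_edist_le (ι := N × N) (fun k => y k.1) (fun k => y k.2)
    (fun k => edist k.1 k.2) fun k => by
      rw [incl_y, incl_y]
      exact a.nonexpansive _ _
  exact ⟨l, ⟨fun n => (G.map f).toFun (y n), fun n n' => hf (n, n')⟩,
    NonexpMap.ext (funext fun n => (incl_map f _).trans (incl_y n))⟩

end Met.filteredColim

theorem Met.exists_lift_of_isColimit {J : Type u} [Category.{v} J]
    [IsCardinalFiltered J (ℵ₁ : Cardinal.{u})] {G : J ⥤ Met.{u}} {s : Limits.Cocone G}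
    (hs : Limits.IsColimit s) {N : Type w} [EMetricSpace N] [Countable N] (a : NonexpMap N s.pt) :
    ∃ (j : J) (b : NonexpMap N (G.obj j)), NonexpMap.comp (s.ι.app j) b = a := by
  let i : Met.filteredColim G ≅ s.pt := (Met.filteredColim.isColimit G).coconePointUniqueUpToIso hs
  obtain ⟨j, b, hb⟩ := Met.filteredColim.exists_lift (NonexpMap.comp i.inv a)
  refine ⟨j, b, ?_⟩
  calc NonexpMap.comp (s.ι.app j) b
      = NonexpMap.comp (Met.filteredColim.incl G j ≫ i.hom) b := by
        rw [← (Met.filteredColim.isColimit G).comp_coconePointUniqueUpToIso_hom hs j]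
        rfl
    _ = NonexpMap.comp i.hom (NonexpMap.comp i.inv a) := congrArg (NonexpMap.comp i.hom) hb
    _ = a := congrArg (fun e : s.pt ⟶ s.pt => NonexpMap.comp e a) i.inv_hom_id

/-! ### Countably filtered colimits of structures -/

namespace SigModel

open Limits Met.filteredColim

variable {Ω : MetricSignature.{u}} {J : Type u} [Category.{v} J]

section Colimit

variable [IsCardinalFiltered J (ℵ₁ : Cardinal.{u})] (K : J ⥤ SigModel Ω)

theorem colim_incl_op {j k : J} (h : j ⟶ k) (f : Ω.Op)
    (c : NonexpMap (Ω.arity f) (K.obj j).space) :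
    (incl (K ⋙ forget Ω) j).toFun ((K.obj j).op f c) =
      (incl (K ⋙ forget Ω) k).toFun ((K.obj k).op f (NonexpMap.comp (K.map h).map c)) :=
  (incl_map (G := K ⋙ forget Ω) h _).symm.trans
    (congrArg (incl (K ⋙ forget Ω) k).toFun ((K.map h).map_op f c))

theorem colim_edist_op_of_stage {m : J} (f : Ω.Op)
    (c d : NonexpMap (Ω.arity f) (K.obj m).space) :
    edist ((incl (K ⋙ forget Ω) m).toFun ((K.obj m).op f c))
        ((incl (K ⋙ forget Ω) m).toFun ((K.obj m).op f d)) ≤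
      edist (NonexpMap.comp (incl (K ⋙ forget Ω) m) c)
        (NonexpMap.comp (incl (K ⋙ forget Ω) m) d) := by
  obtain ⟨l, h, hl⟩ := exists_forall_edist_le (G := K ⋙ forget Ω) c.toFun d.toFun _
    fun _ => le_rfl
  rw [colim_incl_op K h, colim_incl_op K h]
  exact ((incl (K ⋙ forget Ω) l).nonexpansive _ _).trans
    (((K.obj l).op f).nonexpansive _ _ |>.trans (iSup_mono hl))

theorem colim_edist_op {j k : J} (f : Ω.Op) (c : NonexpMap (Ω.arity f) (K.obj j).space)
    (d : NonexpMap (Ω.arity f) (K.obj k).space) :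
    edist ((incl (K ⋙ forget Ω) j).toFun ((K.obj j).op f c))
        ((incl (K ⋙ forget Ω) k).toFun ((K.obj k).op f d)) ≤
      edist (NonexpMap.comp (incl (K ⋙ forget Ω) j) c)
        (NonexpMap.comp (incl (K ⋙ forget Ω) k) d) := by
  have comp_incl {i m : J} (h : i ⟶ m) (e : NonexpMap (Ω.arity f) (K.obj i).space) :
      NonexpMap.comp (incl (K ⋙ forget Ω) m) (NonexpMap.comp (K.map h).map e) =
        NonexpMap.comp (incl (K ⋙ forget Ω) i) e :=
    NonexpMap.ext (funext fun n => incl_map (G := K ⋙ forget Ω) h (e n))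
  rw [colim_incl_op K (IsFiltered.leftToMax j k), colim_incl_op K (IsFiltered.rightToMax j k),
    ← comp_incl (IsFiltered.leftToMax j k), ← comp_incl (IsFiltered.rightToMax j k)]
  exact colim_edist_op_of_stage K f _ _

/-- The value of an operation on the colimit, computed at a stage to which its arguments lift. -/
noncomputable def colimOp (f : Ω.Op)
    (a : NonexpMap (Ω.arity f) (Met.filteredColim (K ⋙ forget Ω))) :
    Met.filteredColim (K ⋙ forget Ω) :=
  have h := exists_lift a
  (incl (K ⋙ forget Ω) h.choose).toFun ((K.obj h.choose).op f h.choose_spec.choose)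

theorem exists_colimOp_eq (f : Ω.Op)
    (a : NonexpMap (Ω.arity f) (Met.filteredColim (K ⋙ forget Ω))) :
    ∃ (j : J) (c : NonexpMap (Ω.arity f) (K.obj j).space),
      NonexpMap.comp (incl (K ⋙ forget Ω) j) c = a ∧
      colimOp K f a = (incl (K ⋙ forget Ω) j).toFun ((K.obj j).op f c) :=
  ⟨_, _, (exists_lift a).choose_spec.choose_spec, rfl⟩

/-- The colimit of a countably filtered diagram of structures. -/
noncomputable def filteredColim : SigModel Ω where
  space := Met.filteredColim (K ⋙ forget Ω)
  op f := ⟨colimOp K f, fun a b => by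
    obtain ⟨j, c, rfl, hc⟩ := exists_colimOp_eq K f a
    obtain ⟨k, d, rfl, hd⟩ := exists_colimOp_eq K f b
    rw [hc, hd]
    exact colim_edist_op K f c d⟩

/-- The homomorphisms into the colimit. -/
noncomputable def colimMk (j : J) : K.obj j ⟶ filteredColim K where
  map := incl (K ⋙ forget Ω) j
  map_op f a := by
    obtain ⟨k, d, hd, colimOp_eq⟩ := exists_colimOp_eq K f
      (NonexpMap.comp (incl (K ⋙ forget Ω) j) a)
    refine (edist_le_zero.1 ((colim_edist_op K f a d).trans ?_)).trans colimOp_eq.symm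
    rw [hd, edist_self]

/-- The colimit cocone of structures. -/
noncomputable def colimCocone : Cocone K where
  pt := filteredColim K
  ι :=
    { app := colimMk K
      naturality := fun _ _ h => Hom.ext ((cocone (K ⋙ forget Ω)).ι.naturality h) }

/-- The universal property of the colimit of structures. -/
noncomputable def isColimitColimCocone : IsColimit (colimCocone K) where
  desc s :=
    { map := desc ((forget Ω).mapCocone s)
      map_op := fun f a => by
        obtain ⟨j, c, rfl, colimOp_eq⟩ := exists_colimOp_eq K f a
        exact (congrArg (desc ((forget Ω).mapCocone s)).toFun colimOp_eq).trans
          ((s.ι.app j).map_op f c) }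
  fac _ _ := rfl
  uniq s m h := Hom.ext ((isColimit (K ⋙ forget Ω)).uniq ((forget Ω).mapCocone s) m.map fun j =>
    congrArg Hom.map (h j))

instance : HasColimitsOfShape J (SigModel Ω) where
  has_colimit K := ⟨⟨⟨colimCocone K, isColimitColimCocone K⟩⟩⟩

instance : PreservesColimitsOfShape J (forget Ω) where
  preservesColimit {K} := preservesColimit_of_preserves_colimit_cocone (isColimitColimCocone K)
    (isColimit (K ⋙ forget Ω))

variable (P : ObjectProperty (SigModel Ω)) [ClosedUnderCountableCovers P]

instance : P.IsClosedUnderColimitsOfShape J where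
  colimitsOfShape_le := by
    rintro M ⟨p⟩
    refine ClosedUnderCountableCovers.of_countablyCoveredBy fun X _ _ a => ?_
    obtain ⟨j, b, hb⟩ :=
      Met.exists_lift_of_isColimit (isColimitOfPreserves (forget Ω) p.isColimit) a
    exact ⟨p.diag.obj j, p.prop_diag_obj j, p.ι.app j, b, hb⟩

end Colimit

instance (P : ObjectProperty (SigModel Ω)) [ClosedUnderCountableCovers P] :
    (forgetOn P).IsCardinalAccessible (ℵ₁ : Cardinal.{u}) where
  preservesColimitOfShape J _ _ := by
    have := createsColimitsOfShapeFullSubcategoryInclusion J P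
    infer_instance

theorem isCardinalAccessible_monad (P : ObjectProperty (SigModel Ω)) [ClosedUnderCountableCovers P]
    (Free : Met.{u} ⥤ P.FullSubcategory) (adj : Free ⊣ forgetOn P) :
    adj.toMonad.toFunctor.IsCardinalAccessible (ℵ₁ : Cardinal.{u}) := by
  have := adj.leftAdjoint_preservesColimits
  exact inferInstanceAs ((Free ⋙ forgetOn P).IsCardinalAccessible (ℵ₁ : Cardinal.{u}))

end SigModel

/-! ### The equivalence with the models of a Lawvere theory -/

namespace SigModel

variable {Ω : MetricSignature.{u}} (P : ObjectProperty (SigModel Ω))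

/-- The arity of an operation, lifted to the universe of the models. -/
def aritySpace (f : Ω.Op) : CMet.{u} :=
  ⟨⟨ULift.{u} (Ω.arity f)⟩, inferInstanceAs (Countable (ULift.{u} (Ω.arity f)))⟩

/-- The generators of the free model on the arity of an operation. -/
noncomputable def arityUnit (f : Ω.Op) :
    NonexpMap (Ω.arity f) (free P (aritySpace f).obj).space :=
  NonexpMap.comp (unit P (aritySpace f).obj) ⟨ULift.up, fun _ _ => le_rfl⟩

/-- An operation applied to the generators of the free model on its arity. -/
noncomputable def genericOp (f : Ω.Op) : (free P (aritySpace f).obj).space :=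
  (free P (aritySpace f).obj).op f (arityUnit P f)

variable {P}

theorem exists_hom_comp_arityUnit (f : Ω.Op) (M : P.FullSubcategory)
    (a : NonexpMap (Ω.arity f) M.obj.space) :
    ∃ φ : free P (aritySpace f).obj ⟶ M.obj, NonexpMap.comp φ.map (arityUnit P f) = a := by
  let a' : (aritySpace f).obj ⟶ M.obj.space := NonexpMap.comp a ⟨ULift.down, fun _ _ => le_rfl⟩
  refine ⟨lift ⟨M, a'⟩, NonexpMap.ext (funext fun i => ?_)⟩
  exact congrArg (NonexpMap.toFun · (ULift.up i)) (unit_lift ⟨M, a'⟩)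

theorem map_genericOp {f : Ω.Op} {M : SigModel Ω} (φ : free P (aritySpace f).obj ⟶ M) :
    φ.map.toFun (genericOp P f) = M.op f (NonexpMap.comp φ.map (arityUnit P f)) :=
  φ.map_op f _

variable [ClosedUnderSeparation P]

instance : (freeAdjunction P).nerve.Full := by
  refine (freeAdjunction P).nerve_full fun {M N} (t : M.obj.space ⟶ N.obj.space) ht => ?_
  refine ⟨ObjectProperty.homMk ⟨t, fun f a => ?_⟩, rfl⟩
  obtain ⟨k, rfl⟩ := exists_hom_comp_arityUnit f M a
  obtain ⟨l, l_eq⟩ := ht (aritySpace f) (ObjectProperty.homMk k)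
  replace l_eq : l.hom.map = NonexpMap.comp t k.map := l_eq
  calc t.toFun (M.obj.op f (NonexpMap.comp k.map (arityUnit P f)))
      = NonexpMap.comp t k.map (genericOp P f) := congrArg t.toFun (map_genericOp k).symm
    _ = l.hom.map.toFun (genericOp P f) := by rw [l_eq]
    _ = N.obj.op f (NonexpMap.comp l.hom.map (arityUnit P f)) := map_genericOp l.hom
    _ = N.obj.op f (NonexpMap.comp (NonexpMap.comp t k.map) (arityUnit P f)) := by
      rw [l_eq]
      rfl

section Structure

variable (N : (freeAdjunction P).lawvereTheory.Mod)

/-- The value of the model `N` at the generator, with the operations that the generic operations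
induce. -/
noncomputable def structureOf : SigModel Ω where
  space := (freeAdjunction P).lawvereTheory.forget.obj N
  op f :=
    { toFun a := ((freeAdjunction P).evalAt ((freeAdjunction P).tuple (aritySpace f)
        (NonexpMap.comp a ⟨ULift.down, fun _ _ => le_rfl⟩))).toFun (genericOp P f)
      nonexpansive a b := by
        refine (NonexpMap.edist_apply_le _ _ _).trans
          (((freeAdjunction P).edist_evalAt_le _ _).trans ?_)
        rw [IsometryEquiv.edist_eq]
        exact iSup_le fun i => NonexpMap.edist_apply_le a b (ULift.down i) }

variable {N}

theorem structureOf_op {f : Ω.Op} (a : N.obj.obj (aritySpace f)) :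
    (structureOf N).op f (NonexpMap.comp ((freeAdjunction P).evalAt a) (arityUnit P f)) =
      ((freeAdjunction P).evalAt a).toFun (genericOp P f) :=
  congrArg (fun b => ((freeAdjunction P).evalAt b).toFun (genericOp P f))
    ((freeAdjunction P).tuple_unit_comp_evalAt a)

/-- The evaluation at `a` of the elements of the free model on `A`, as a homomorphism. -/
noncomputable def evalHom {A : MetAdjunction.TheoryObj (freeFunctor P)} (a : N.obj.obj A) :
    free P A.space ⟶ structureOf N where
  map := (freeAdjunction P).evalAt a
  map_op f b := by
    obtain ⟨φ, rfl⟩ := exists_hom_comp_arityUnit f (freeModel P _) b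
    let φ' : freeModel P (aritySpace f).obj ⟶ freeModel P A.space :=
      ObjectProperty.homMk φ
    let ψ : A ⟶ aritySpace f := InducedCategory.homMk φ'.op
    have evalAt_ψ : (freeAdjunction P).evalAt ((N.obj.map ψ).toFun a) =
        NonexpMap.comp ((freeAdjunction P).evalAt a) φ.map := (freeAdjunction P).evalAt_map ψ a
    have op_ψ := structureOf_op ((N.obj.map ψ).toFun a)
    rw [evalAt_ψ] at op_ψ
    exact (congrArg ((freeAdjunction P).evalAt a).toFun (map_genericOp φ).symm).trans op_ψ.symm

variable (N) [ClosedUnderCountableCovers P]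

/-- The member of the class `P` that a model of its Lawvere theory determines. -/
noncomputable def modelOf : P.FullSubcategory where
  obj := structureOf N
  property := ClosedUnderCountableCovers.of_countablyCoveredBy fun X _ _ a =>
    let A : CMet.{u} := ⟨⟨X⟩, inferInstanceAs (Countable X)⟩
    ⟨free P ⟨X⟩, (freeModel P ⟨X⟩).property, evalHom ((freeAdjunction P).tuple A a), unit P ⟨X⟩,
      (freeAdjunction P).unit_comp_evalAt_tuple (A := A) a⟩

end Structure

variable [ClosedUnderCountableCovers P]

instance : (freeAdjunction P).nerve.EssSurj :=
  (freeAdjunction P).nerve_essSurj fun N => ⟨modelOf N, Iso.refl _, fun a =>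
    ⟨ObjectProperty.homMk (evalHom a), Category.comp_id _⟩⟩

instance : (freeAdjunction P).nerve.IsEquivalence where
  faithful := (freeAdjunction P).nerve_faithful

end SigModel

theorem mainTheorem5_general {Ω : MetricSignature.{u}} (P : ObjectProperty (SigModel Ω))
    [SigModel.ClosedUnderSeparation P] [SigModel.ClosedUnderCountableCovers P] :
    ((SigModel.forgetOn P).IsRightAdjoint ∧
      ∀ (Free : Met.{u} ⥤ P.FullSubcategory) (adj : Free ⊣ SigModel.forgetOn P),
        adj.toMonad.toFunctor.IsCardinalAccessible (ℵ₁ : Cardinal.{u})) ∧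
    ∃ (L : MetLawvereTheory.{u}) (e : P.FullSubcategory ≌ L.Mod),
      Nonempty (e.functor ⋙ L.forget ≅ SigModel.forgetOn P) :=
  ⟨⟨(SigModel.freeAdjunction P).isRightAdjoint, SigModel.isCardinalAccessible_monad P⟩,
    (SigModel.freeAdjunction P).lawvereTheory, (SigModel.freeAdjunction P).nerve.asEquivalence,
    ⟨(SigModel.freeAdjunction P).nerveForgetIso⟩⟩

theorem mainTheorem5 {Ω : MetricSignature.{u}} (T : MetricEquationalTheory Ω) :
    (T.forget.IsRightAdjoint ∧
      ∀ (Free : Met.{u} ⥤ T.Mod) (adj : Free ⊣ T.forget),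
        adj.toMonad.toFunctor.IsCardinalAccessible (ℵ₁ : Cardinal.{u})) ∧
    ∃ (L : MetLawvereTheory.{u}) (e : T.Mod ≌ L.Mod),
      Nonempty (e.functor ⋙ L.forget ≅ T.forget) :=
  mainTheorem5_general (SigModel.satisfying T.judgments)
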